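/- Let $Q(z)=\sum_{j=1}^N p_j z^j$ with $p_j\ge 0$ and $\sum_{j=1}^N p_j=1$. Put $$q=Q'(1),\qquad \kappa=\exp\Bigl(\int_0^1\Bigl(\frac1{1-z}-\frac{q}{1-Q(z)}\Bigr)\,dz\Bigr),$$ and let $\phi$ be the analytic function on the unit disc $\{|z|<1\}$ with $\phi(0)=0$ and $\phi'(z)=\frac1{1-Q(z)}$. Let $w^*(y)=1/y$ for $y\ge 1$ and $w^*(y)=0$ for $y<1$. For a real-valued function $f$ on $(1,\infty)$ write $\widehat f(\xi)=\int_1^\infty e^{-i\xi x}f(x)\,dx$, and for $\gamma\ge 0$ let $L^2_\gamma$ be the space of $f\in L^1_{\mathrm{loc}}([1,\infty),\mathbb R)$ with $\int_1^\infty (y^\gamma|f(y)|)^2\,dy<\infty$. Let $P_\gamma$ be the set of all $\eta\in L^2_\gamma\cap L^1((1,\infty))$ with $\eta\ge 0$ a.e. and $\int_1^\infty\eta(y)\,dy=1$. For $\eta\in P_\gamma$, $\mathcal N(\eta)=\mathcal F^{-1}(\phi(\mathcal F\eta))$ denotes the function $w\in L^1_{\mathrm{loc}}([1,\infty),\mathbb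 R)$ for which, for every $\xi\in\mathbb C$ with $\operatorname{Im}\xi<0$, the integral $\widehat w(\xi)$ converges absolutely and $\widehat w(\xi)=\phi(\widehat\eta(\xi))$. Let $\gamma>3/2$ and $\eta\in P_\gamma$. Then $\mathcal N(\eta)$ exists, is unique up to equality almost everywhere, and $$\mathcal N(\eta)=\frac1q\,w^*+d\quad\text{a.e. on }(1,\infty),\qquad d\in L^2_{\gamma-1}.$$ Moreover $\mu=\int_1^\infty y\,\eta(y)\,dy$ is finite, $d$ is integrable on $(1,\infty)$, and $$\int_1^\infty d(y)\,dy=\frac1q\bigl(\gamma_E-\log(\kappa\mu)\bigr),$$ where $\gamma_E$ is Euler's constant. -/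

import Mathlib

open MeasureTheory Set Polynomial

namespace Coarsening

/-- `Q(z) = ∑_{j=1}^N p_j z^j` with `p_j ≥ 0` and `p_1 + ⋯ + p_N = 1`. -/
structure IsMergingPolynomial (Q : ℝ[X]) : Prop where
  coeff_zero : Q.coeff 0 = 0
  coeff_nonneg : ∀ j, 0 ≤ Q.coeff j
  eval_one : Q.eval 1 = 1

/-- `q = Q'(1)`. -/
noncomputable def q (Q : ℝ[X]) : ℝ := (derivative Q).eval 1

/-- `κ = exp (∫₀¹ (1/(1-z) - q/(1-Q(z))) dz)`; the integrand is bounded on `(0,1)`. -/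
noncomputable def kappa (Q : ℝ[X]) : ℝ :=
  Real.exp (∫ z in (0 : ℝ)..1, (1 / (1 - z) - q Q / (1 - Q.eval z)))

/-- The primitive of `1/(1-Q)` on the open unit disc that vanishes at `0`, as the integral of
`1/(1-Q)` along the segment from `0` to `z`. (Only its values for `|z| < 1` are meaningful.) -/
noncomputable def phi (Q : ℝ[X]) (z : ℂ) : ℂ :=
  ∫ t in (0 : ℝ)..1, z / (1 - aeval ((t : ℂ) * z) Q)

/-- The Fourier(-Laplace) transform `∫_1^∞ e^{-iξx} f(x) dx` of a function on `(1,∞)`. -/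
noncomputable def fourier (f : ℝ → ℝ) (ξ : ℂ) : ℂ :=
  ∫ x in Ioi (1 : ℝ), Complex.exp (-Complex.I * ξ * x) * (f x : ℂ)

/-- Probability densities on `(1,∞)`. Values of `η` outside `(1,∞)` are irrelevant. -/
structure MemP (η : ℝ → ℝ) : Prop where
  integrable : IntegrableOn η (Ioi 1)
  nonneg : ∀ᵐ y ∂(volume.restrict (Ioi (1 : ℝ))), 0 ≤ η y
  integral_eq_one : ∫ y in Ioi (1 : ℝ), η y = 1

/-- The weighted space `L²_γ`: `w ∈ L¹_loc([1,∞))` with `∫_1^∞ (y^γ |w(y)|)² dy < ∞`. -/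
structure MemL2 (γ : ℝ) (w : ℝ → ℝ) : Prop where
  locallyIntegrable : LocallyIntegrableOn w (Ici 1)
  memLp : MemLp (fun y : ℝ => y ^ γ * w y) 2 (volume.restrict (Ioi 1))

/-- `w` is (a representative of) `𝒩(η) = 𝓕⁻¹(φ(𝓕 η))`: a function `w ∈ L¹_loc([1,∞))` whose
Fourier-Laplace transform exists in the open lower half plane and is `φ(𝓕 η)` there. -/
structure IsN (Q : ℝ[X]) (η w : ℝ → ℝ) : Prop where
  locallyIntegrable : LocallyIntegrableOn w (Ici 1)
  integrable : ∀ ξ : ℂ, ξ.im < 0 →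
    IntegrableOn (fun x : ℝ => Complex.exp (-Complex.I * ξ * x) * (w x : ℂ)) (Ioi 1)
  fourier_eq : ∀ ξ : ℂ, ξ.im < 0 → fourier w ξ = phi Q (fourier η ξ)

/-- `w*(y) = 1/y` for `y ≥ 1` and `0` for `y < 1`. -/
noncomputable def wstar (y : ℝ) : ℝ := if 1 ≤ y then 1 / y else 0

end Coarsening

/-! ### Plancherel and uniqueness for Fourier transforms of integrable functions. -/

namespace Coarsening
open scoped FourierTransform SchwartzMap ENNReal

/-! Put `z = iξ` and write hats for Laplace transforms. Differentiating `ŵ = φ(η̂)` shows that `y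
w(y)` must have the transform `ĝ / (1 - Q(η̂))` with `g(y) = y η(y)`. Here `Q(η̂) = ρ̂` for a
probability density `ρ` (a mixture of convolution powers of `η`), and `1 - ρ̂ = z T̂`, where `T` is
the tail integral of `ρ`. So there is a simple pole at `0`, with residue `∫ g / ∫ T = 1/q`; this is
the source of `w*/q`.

Subtracting `(1/q) e^{-z}/z`, the transform of `1/q` on `(1,∞)`, leaves `Ĝ / (1 - ρ̂)` with `G = g -
(1/q) T(· - 1)` and `∫ G = 0`. To invert `1 - ρ̂` despite its zero at `0`, take `f = ρ - T`, for
which `1 - f̂ = (1 - ρ̂)(1 + z)/z` is bounded away from zero in the right half plane. If `k` is its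
resolvent, then `1/(1 - ρ̂) = (1 + k̂)(1 + 1/z)`. Because `∫ G = 0`, `(1 + 1/z) Ĝ` is the transform
of `K = G - tail G`, and the remainder is `E = K + k ⋆ K`; finally `d = E / y`. This is
`Dens.exists_remainder`.

The weights are tracked as follows. `hardy` costs one power of decay per tail integral, so `f` has
weight `γ - 1` and `K` has weight `γ - 2` in `L²`. A quantitative Wiener lemma makes `k` integrable
with weight `max (γ - 2) 0`: `IsResolvent.nrm_zero_lt_top` gets plain integrability from Plancherel
applied to differences of exponential tilts, and `IsResolvent.nrm_lt_top` then raises the weight in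
steps smaller than one. The kernel `k` itself is built from the renewal density of `ρ` in
`Dens.exists_isResolvent`. Convolution with `k` preserves weight `γ - 2`, and division by `y`
restores one power.

`Dens.lap_div_id_eq_phi` integrates the differentiated equation back, and `IsN.ae_eq` gives
uniqueness. For `∫ d`, let `s → 0+` in `d̂(s) = φ(η̂(s)) - (1/q) ∫_1^∞ e^{-sx}/x dx`: the logarithms
of `s` cancel, `1 - η̂(s) ~ μ s` gives `log μ`, the regular part of `φ` at `1` gives `log κ`, and
the exponential integral gives Euler's constant. -/

lemma integral_fourier_mul_schwartz {a : ℝ → ℂ} (ha : Integrable a) (g : 𝓢(ℝ, ℂ)) :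
    ∫ t, 𝓕 a t * g t = ∫ x, a x * 𝓕 g x := by
  have := VectorFourier.integral_fourierIntegral_smul_eq_flip (L := innerₗ ℝ)
    (μ := volume) (ν := volume) Real.continuous_fourierChar continuous_inner ha g.integrable
  simpa [Real.fourier_eq, VectorFourier.fourierIntegral, SchwartzMap.fourier_coe, mul_comm] using this

lemma ae_eq_of_schwartz {a b : ℝ → ℂ} (ha : LocallyIntegrable a) (hb : LocallyIntegrable b)
    (h : ∀ g : 𝓢(ℝ, ℂ), ∫ x, a x * g x = ∫ x, b x * g x) : a =ᵐ[volume] b := by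
  refine ae_eq_of_integral_contDiff_smul_eq ha hb fun g hg hgc ↦ ?_
  let G : 𝓢(ℝ, ℂ) := HasCompactSupport.toSchwartzMap (f := fun x ↦ (g x : ℂ))
    (hgc.comp_left (g := ((↑) : ℝ → ℂ)) (by simp)) (Complex.ofRealCLM.contDiff.comp hg)
  have hG : ∀ x, G x = g x := fun _ ↦ rfl
  simpa [hG, mul_comm] using h G

/-- The `L²` transform is defined by extension, the other by an integral; both satisfy the same
duality with Schwartz functions, which determines them. -/
lemma fourier_toLp_ae {a : ℝ → ℂ} (h1 : Integrable a) (h2 : MemLp a 2) :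
    (𝓕 (h2.toLp a) : Lp ℂ 2 (volume : Measure ℝ)) =ᵐ[volume] 𝓕 a := by
  refine ae_eq_of_schwartz ((Lp.memLp _).locallyIntegrable (by norm_num))
    (Continuous.locallyIntegrable ?_) fun g ↦ ?_
  · exact VectorFourier.fourierIntegral_continuous Real.continuous_fourierChar
      (L := innerₗ ℝ) continuous_inner h1
  · rw [integral_fourier_mul_schwartz h1]
    have := congrArg (fun T ↦ T g) (Lp.fourier_toTemperedDistribution_eq (h2.toLp a))
    simp only [TemperedDistribution.fourier_apply, Lp.toTemperedDistribution_apply] at this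
    simp only [smul_eq_mul, mul_comm] at this ⊢
    rw [← this]
    refine integral_congr_ae ?_
    filter_upwards [h2.coeFn_toLp] with x hx
    rw [hx]

lemma eLpNorm_fourier {a : ℝ → ℂ} (h1 : Integrable a) (h2 : MemLp a 2) :
    eLpNorm (𝓕 a) 2 volume = eLpNorm a 2 volume := by
  rw [← eLpNorm_congr_ae (fourier_toLp_ae h1 h2), ← eLpNorm_congr_ae h2.coeFn_toLp]
  have := Lp.norm_fourier_eq (h2.toLp a)
  rw [Lp.norm_def, Lp.norm_def] at this
  exact (ENNReal.toReal_eq_toReal_iff' (Lp.eLpNorm_ne_top _) (Lp.eLpNorm_ne_top _)).1 this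

lemma lintegral_enorm_sq_le_of_fourier {a b : ℝ → ℂ} (ha : Integrable a) (ha2 : MemLp a 2)
    (hb : Integrable b) (hb2 : MemLp b 2) {C : ℝ} (h : ∀ t, ‖𝓕 a t‖ ≤ C * ‖𝓕 b t‖) :
    ∫⁻ x, ‖a x‖ₑ ^ 2 ≤ ENNReal.ofReal C ^ 2 * ∫⁻ x, ‖b x‖ₑ ^ 2 := by
  have e (f : ℝ → ℂ) : ∫⁻ x, ‖f x‖ₑ ^ 2 = eLpNorm f 2 volume ^ 2 := by
    rw [eLpNorm_eq_lintegral_rpow_enorm_toReal (by norm_num) (by norm_num), ← ENNReal.rpow_natCast,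
      ← ENNReal.rpow_mul]
    simp
  rw [e, e, ← mul_pow, ← eLpNorm_fourier ha ha2, ← eLpNorm_fourier hb hb2]
  gcongr
  exact eLpNorm_le_mul_eLpNorm_of_ae_le_mul (Filter.Eventually.of_forall h) 2

/-- Every Schwartz function is a Fourier transform, so duality makes `a` orthogonal to all of them.
-/
lemma ae_eq_zero_of_fourier_eq_zero {a : ℝ → ℂ} (ha : Integrable a) (h : ∀ t, 𝓕 a t = 0) :
    a =ᵐ[volume] 0 := by
  refine ae_eq_of_schwartz ha.locallyIntegrable (integrable_zero ℝ ℂ volume).locallyIntegrable fun g ↦ ?_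
  have := integral_fourier_mul_schwartz ha (𝓕⁻ g)
  simp only [h, zero_mul, integral_zero, FourierTransform.fourier_fourierInv_eq] at this
  simp [← this]

end Coarsening

/-! ### Weighted inequalities: Cauchy–Schwarz, Young, fractional scaling integrals, Hardy. -/

namespace Coarsening
open scoped ENNReal

lemma sq_lintegral_mul_le {α : Type*} [MeasurableSpace α] (μ : Measure α) {f g : α → ℝ≥0∞}
    (hf : AEMeasurable f μ) (hg : AEMeasurable g μ) :
    (∫⁻ x, f x * g x ∂μ) ^ 2 ≤ (∫⁻ x, f x ^ 2 ∂μ) * ∫⁻ x, g x ^ 2 ∂μ := by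
  have h := ENNReal.lintegral_mul_le_Lp_mul_Lq μ Real.HolderConjugate.two_two hf hg
  simp only [Pi.mul_apply, ENNReal.rpow_two] at h
  calc _ ≤ ((∫⁻ x, f x ^ 2 ∂μ) ^ (1 / 2 : ℝ) * (∫⁻ x, g x ^ 2 ∂μ) ^ (1 / 2 : ℝ)) ^ 2 := by gcongr
    _ = _ := by
      rw [mul_pow, ← ENNReal.rpow_natCast, ← ENNReal.rpow_natCast, ← ENNReal.rpow_mul,
        ← ENNReal.rpow_mul]
      norm_num

/-- Cauchy–Schwarz for the measure `f dμ`, obtained by splitting `f` into two square roots. Used to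
derive Young's inequality for `L¹ ⋆ L²`. -/
lemma sq_lintegral_mul_le' {α : Type*} [MeasurableSpace α] (μ : Measure α) {f g : α → ℝ≥0∞}
    (hf : AEMeasurable f μ) (hg : AEMeasurable g μ) :
    (∫⁻ x, f x * g x ∂μ) ^ 2 ≤ (∫⁻ x, f x ∂μ) * ∫⁻ x, f x * g x ^ 2 ∂μ := by
  have e (y : ℝ≥0∞) : y = (y ^ (1 / 2 : ℝ)) * (y ^ (1 / 2 : ℝ)) := by
    rw [← ENNReal.rpow_add_of_nonneg _ _ (by norm_num) (by norm_num)]; norm_num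
  have e2 (y : ℝ≥0∞) : (y ^ (1 / 2 : ℝ)) ^ 2 = y := by rw [pow_two, ← e]
  have := sq_lintegral_mul_le μ (f := fun x ↦ f x ^ (1 / 2 : ℝ))
    (g := fun x ↦ f x ^ (1 / 2 : ℝ) * g x) (by fun_prop) (by fun_prop)
  simpa only [mul_pow, e2, ← mul_assoc, ← e] using this

section lconvolution

lemma lintegral_lconvolution {A B : ℝ → ℝ≥0∞} (hA : Measurable A) (hB : Measurable B) :
    ∫⁻ x, (A ⋆ₗ B) x = (∫⁻ x, A x) * ∫⁻ x, B x := by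
  simp only [lconvolution_def]
  rw [lintegral_lintegral_swap (by fun_prop), ← lintegral_mul_const _ hA]
  refine lintegral_congr fun y ↦ ?_
  rw [lintegral_const_mul _ (by fun_prop), lintegral_add_left_eq_self]

lemma lintegral_lconvolution_sq_le {A B : ℝ → ℝ≥0∞} (hA : Measurable A) (hB : Measurable B) :
    ∫⁻ x, (A ⋆ₗ B) x ^ 2 ≤ (∫⁻ x, A x) ^ 2 * ∫⁻ x, B x ^ 2 := by
  calc _ ≤ ∫⁻ x, (∫⁻ y, A y) * (A ⋆ₗ fun t ↦ B t ^ 2) x := by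
        refine lintegral_mono fun x ↦ ?_
        exact sq_lintegral_mul_le' volume hA.aemeasurable (by fun_prop)
    _ = _ := by
        rw [lintegral_const_mul _ (measurable_lconvolution _ hA (by fun_prop)),
          lintegral_lconvolution hA (by fun_prop), pow_two, mul_assoc]

end lconvolution

section weights

/-- The weight `(1 + |x|) ^ c`. -/
noncomputable def wt (c x : ℝ) : ℝ≥0∞ := ENNReal.ofReal ((1 + |x|) ^ c)

@[fun_prop]
lemma measurable_wt (c : ℝ) : Measurable (wt c) := by unfold wt; fun_prop

lemma one_add_abs_pos (x : ℝ) : 0 < 1 + |x| := by positivity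

lemma wt_mul (c d x : ℝ) : wt c x * wt d x = wt (c + d) x := by
  rw [wt, wt, wt, ← ENNReal.ofReal_mul (by positivity), ← Real.rpow_add (one_add_abs_pos x)]

@[simp] lemma wt_zero (x : ℝ) : wt 0 x = 1 := by simp [wt]

lemma wt_ne_top (c x : ℝ) : wt c x ≠ ∞ := ENNReal.ofReal_ne_top

lemma wt_mono {c d : ℝ} (h : c ≤ d) (x : ℝ) : wt c x ≤ wt d x :=
  ENNReal.ofReal_le_ofReal (Real.rpow_le_rpow_of_exponent_le (by simp) h)

lemma wt_add_le {c : ℝ} (hc : 0 ≤ c) (x y : ℝ) : wt c (x + y) ≤ wt c x * wt c y := by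
  rw [wt, wt, wt, ← ENNReal.ofReal_mul (by positivity),
    ← Real.mul_rpow (by positivity) (by positivity)]
  refine ENNReal.ofReal_le_ofReal (Real.rpow_le_rpow (by positivity) ?_ hc)
  nlinarith [abs_add_le x y, mul_nonneg (abs_nonneg x) (abs_nonneg y)]

lemma wt_add_le_of_nonpos {c x y : ℝ} (hc : c ≤ 0) (hx : 0 ≤ x) (hy : 0 ≤ y) :
    wt c (x + y) ≤ wt c y := by
  refine ENNReal.ofReal_le_ofReal (Real.rpow_le_rpow_of_nonpos (by positivity) ?_ hc)
  rw [abs_of_nonneg hy, abs_of_nonneg (by positivity)]; linarith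

lemma wt_add_le_add {c : ℝ} (hc : 0 ≤ c) (x y : ℝ) :
    wt c (x + y) ≤ ENNReal.ofReal (2 ^ c) * (wt c x + wt c y) := by
  wlog h : |x| ≤ |y| generalizing x y
  · rw [add_comm x, add_comm (wt c x)]; exact this y x (le_of_not_ge h)
  calc wt c (x + y) ≤ ENNReal.ofReal (2 ^ c * (1 + |y|) ^ c) := by
        rw [← Real.mul_rpow (by positivity) (by positivity)]
        refine ENNReal.ofReal_le_ofReal (Real.rpow_le_rpow (by positivity) ?_ hc)
        linarith [abs_add_le x y]
    _ = ENNReal.ofReal (2 ^ c) * wt c y := ENNReal.ofReal_mul (by positivity)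
    _ ≤ _ := by gcongr; exact le_add_self

/-- The norm of `L¹` with weight `(1 + |x|) ^ c`. -/
noncomputable def nrm (c : ℝ) (v : ℝ → ℝ) : ℝ≥0∞ := ∫⁻ x, wt c x * ‖v x‖ₑ

/-- The squared norm of `L²` with weight `(1 + |x|) ^ c`. -/
noncomputable def sqn (c : ℝ) (v : ℝ → ℝ) : ℝ≥0∞ := ∫⁻ x, (wt c x * ‖v x‖ₑ) ^ 2

lemma nrm_mono {c d : ℝ} (h : c ≤ d) (v : ℝ → ℝ) : nrm c v ≤ nrm d v :=
  lintegral_mono fun x ↦ by gcongr; exact wt_mono h x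

lemma sqn_mono {c d : ℝ} (h : c ≤ d) (v : ℝ → ℝ) : sqn c v ≤ sqn d v :=
  lintegral_mono fun x ↦ by gcongr; exact wt_mono h x

lemma nrm_add_le (c : ℝ) {u v : ℝ → ℝ} (hu : Measurable u) :
    nrm c (fun x ↦ u x + v x) ≤ nrm c u + nrm c v := by
  rw [nrm, nrm, nrm, ← lintegral_add_left (by fun_prop)]
  refine lintegral_mono fun x ↦ ?_
  rw [← mul_add]; gcongr; exact enorm_add_le _ _

lemma sqn_add_le (c : ℝ) {u v : ℝ → ℝ} (hu : Measurable u) :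
    sqn c (fun x ↦ u x + v x) ≤ 2 * sqn c u + 2 * sqn c v := by
  rw [sqn, sqn, sqn, ← lintegral_const_mul _ (by fun_prop), ← lintegral_const_mul' _ _ (by simp),
    ← lintegral_add_left (by fun_prop)]
  refine lintegral_mono fun x ↦ ?_
  calc _ ≤ (wt c x * ‖u x‖ₑ + wt c x * ‖v x‖ₑ) ^ 2 := by
        rw [← mul_add]; gcongr; exact enorm_add_le _ _
    _ ≤ _ := by
        rw [← mul_add (2 : ℝ≥0∞)]
        have := ENNReal.rpow_add_le_mul_rpow_add_rpow (wt c x * ‖u x‖ₑ) (wt c x * ‖v x‖ₑ)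
          (p := 2) (by norm_num)
        norm_num at this
        exact this

/-- Cauchy–Schwarz against `(1 + |x|)^(c - b)`, which is square integrable exactly because `b - c >
1/2`. -/
lemma nrm_lt_top_of_sqn {b c : ℝ} (h : c + 1 / 2 < b) {v : ℝ → ℝ} (hv : Measurable v)
    (hs : sqn b v < ∞) : nrm c v < ∞ := by
  have h1 : nrm c v = ∫⁻ x, wt (c - b) x * (wt b x * ‖v x‖ₑ) := by
    refine lintegral_congr fun x ↦ ?_
    rw [← mul_assoc, wt_mul, sub_add_cancel]
  have h2 : ∫⁻ x, wt (c - b) x ^ 2 < ∞ := by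
    have := finite_integral_one_add_norm (E := ℝ) (μ := volume) (r := 2 * (b - c)) (by simp; linarith)
    convert this using 3 with x
    rw [pow_two, wt_mul, wt, Real.norm_eq_abs]; ring_nf
  have h3 : nrm c v ^ 2 < ∞ := by
    rw [h1]
    exact (sq_lintegral_mul_le volume (by fun_prop) (by fun_prop)).trans_lt (ENNReal.mul_lt_top h2 hs)
  simpa using h3

end weights

section scaling

lemma lintegral_Ioi_eq_mul_comp_mul {x : ℝ} (hx : 0 < x) (F : ℝ → ℝ≥0∞) :
    ∫⁻ u in Ioi (0 : ℝ), F u = ENNReal.ofReal x * ∫⁻ h in Ioi (0 : ℝ), F (h * x) := by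
  have e : MeasurableEmbedding fun h : ℝ ↦ h * x :=
    (Homeomorph.mulRight₀ x hx.ne').measurableEmbedding
  have h1 : ENNReal.ofReal x • (volume : Measure ℝ).map (· * x) = volume := by
    simpa [abs_of_pos hx] using Real.smul_map_volume_mul_right hx.ne'
  rw [← lintegral_indicator measurableSet_Ioi, ← lintegral_indicator measurableSet_Ioi]
  conv_lhs => rw [← h1]
  rw [lintegral_smul_measure, e.lintegral_map, smul_eq_mul]
  congr 1
  refine lintegral_congr fun h ↦ ?_
  by_cases hh : 0 < h
  · rw [indicator_of_mem (by exact mul_pos hh hx), indicator_of_mem (by exact hh)]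
  · rw [indicator_of_notMem (by simp [mul_pos_iff_of_pos_right hx, hh]),
      indicator_of_notMem (by simpa using hh)]

lemma lintegral_Ioi_comp_mul {m : ℝ → ℝ≥0∞} {α x : ℝ} (hx : 0 < x) :
    ∫⁻ h in Ioi (0 : ℝ), ENNReal.ofReal (h ^ (-1 - α)) * m (h * x) =
      (∫⁻ u in Ioi (0 : ℝ), ENNReal.ofReal (u ^ (-1 - α)) * m u) * ENNReal.ofReal (x ^ α) := by
  conv_rhs => rw [lintegral_Ioi_eq_mul_comp_mul hx]
  rw [mul_right_comm, ← ENNReal.ofReal_mul hx.le,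
    ← lintegral_const_mul' _ _ ENNReal.ofReal_ne_top]
  refine setLIntegral_congr_fun measurableSet_Ioi fun h hh ↦ ?_
  have hh : 0 < h := hh
  rw [← mul_assoc, ← ENNReal.ofReal_mul (by positivity), Real.mul_rpow hh.le hx.le]
  congr 2
  have : x * x ^ α * x ^ (-1 - α) = 1 := by
    nth_rewrite 1 [← Real.rpow_one x]
    rw [← Real.rpow_add hx, ← Real.rpow_add hx]; norm_num
  linear_combination (-h ^ (-1 - α)) * this

/-- Scaling `u = h x` pulls out `x ^ α`. The remaining constant is finite: `α < p` gives convergence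
at `0`, where `1 - e^{-u} ≤ u`, and `0 < α` at infinity. This turns bounds on exponential tilts into
bounds with power weights. -/
lemma lintegral_one_sub_exp_pow {p : ℕ} {α : ℝ} (h0 : 0 < α) (hp : α < p) :
    ∃ c : ℝ≥0∞, c ≠ 0 ∧ c ≠ ∞ ∧ ∀ x : ℝ, 0 < x →
      ∫⁻ h in Ioi (0 : ℝ), ENNReal.ofReal (h ^ (-1 - α)) * ENNReal.ofReal (1 - Real.exp (-(h * x))) ^ p
        = c * ENNReal.ofReal (x ^ α) := by
  refine ⟨∫⁻ u in Ioi (0 : ℝ), ENNReal.ofReal (u ^ (-1 - α)) *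
    ENNReal.ofReal (1 - Real.exp (-u)) ^ p, ?_, ?_, fun x hx ↦ lintegral_Ioi_comp_mul (m := fun u ↦ ENNReal.ofReal (1 - Real.exp (-u)) ^ p) hx⟩
  · refine (setLIntegral_pos_iff (by fun_prop) |>.2 ?_).ne'
    refine lt_of_lt_of_le (b := volume (Ioi (0 : ℝ))) (by simp) (measure_mono fun u hu ↦ ⟨?_, hu⟩)
    have hu : 0 < u := hu
    have : 0 < u ^ (-1 - α) := by positivity
    simp [this, hu]
  · rw [← Ioc_union_Ioi_eq_Ioi zero_le_one, lintegral_union measurableSet_Ioi (by simp)]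
    refine (ENNReal.add_lt_top.2 ⟨?_, ?_⟩).ne
    · have h1 : IntegrableOn (fun u : ℝ ↦ u ^ (p - 1 - α)) (Ioc 0 1) :=
        (intervalIntegrable_iff_integrableOn_Ioc_of_le zero_le_one).1
          (intervalIntegral.intervalIntegrable_rpow' (by linarith))
      refine lt_of_le_of_lt (setLIntegral_mono' measurableSet_Ioc fun u hu ↦ ?_) h1.lintegral_lt_top
      rw [← ENNReal.ofReal_pow (by simpa using hu.1.le), ← ENNReal.ofReal_mul (by have := hu.1; positivity)]
      refine ENNReal.ofReal_le_ofReal ?_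
      rw [show (p : ℝ) - 1 - α = (-1 - α) + p by ring, Real.rpow_add hu.1, Real.rpow_natCast]
      have := hu.1
      gcongr
      · simpa using hu.1.le
      · linarith [Real.add_one_le_exp (-u)]
    · have h1 : IntegrableOn (fun u : ℝ ↦ u ^ (-1 - α)) (Ioi 1) :=
        integrableOn_Ioi_rpow_of_lt (by linarith) one_pos
      refine lt_of_le_of_lt (setLIntegral_mono' measurableSet_Ioi fun u hu ↦ ?_) h1.lintegral_lt_top
      refine mul_le_of_le_one_right' (pow_le_one' ?_ _)
      rw [ENNReal.ofReal_le_one]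
      linarith [Real.exp_pos (-u)]

end scaling

section Hardy

lemma lintegral_Ioi_wt {r x : ℝ} (hr : r < -1) (hx : 0 ≤ x) :
    ∫⁻ t in Ioi x, wt r t = ENNReal.ofReal (1 / (-r - 1)) * wt (r + 1) x := by
  have hd : ∀ t ∈ Ici x, HasDerivAt (fun t ↦ (1 + t) ^ (r + 1) / (r + 1)) ((1 + t) ^ r) t := by
    intro t ht
    have ht : x ≤ t := ht
    have h0 : 0 < 1 + t := by linarith
    have := ((hasDerivAt_id t).const_add 1).rpow_const (p := r + 1) (Or.inl h0.ne')
    have hr' : r + 1 ≠ 0 := by linarith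
    exact (this.div_const (r + 1)).congr_deriv (by simp [hr'])
  have hlim : Filter.Tendsto (fun t : ℝ ↦ (1 + t) ^ (r + 1) / (r + 1)) Filter.atTop (nhds 0) := by
    have h := (tendsto_rpow_neg_atTop (y := -(r + 1)) (by linarith)).comp
      (Filter.tendsto_atTop_add_const_left Filter.atTop (1 : ℝ) Filter.tendsto_id)
    simpa using h.div_const (r + 1)
  have hnn : ∀ t ∈ Ioi x, 0 ≤ (1 + t) ^ r := fun t ht ↦ by
    have : x < t := ht
    have : 0 < t := by linarith
    positivity
  have h1 : ∫⁻ t in Ioi x, wt r t = ∫⁻ t in Ioi x, ENNReal.ofReal ((1 + t) ^ r) :=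
    setLIntegral_congr_fun measurableSet_Ioi fun t ht ↦ by
      rw [wt, abs_of_nonneg (hx.trans (le_of_lt ht))]
  rw [h1, ← ofReal_integral_eq_lintegral_ofReal (integrableOn_Ioi_deriv_of_nonneg' hd hnn hlim)
    (ae_restrict_of_forall_mem measurableSet_Ioi hnn),
    integral_Ioi_of_hasDerivAt_of_tendsto' hd (integrableOn_Ioi_deriv_of_nonneg' hd hnn hlim) hlim,
    wt, ← ENNReal.ofReal_mul (by rw [one_div, inv_nonneg]; linarith), abs_of_nonneg hx]
  congr 1
  have : -r - 1 ≠ 0 := by linarith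
  have : r + 1 ≠ 0 := by linarith
  field_simp
  ring

lemma setLIntegral_Ioo_wt_le {r t : ℝ} (hr : -1 < r) (ht : 0 ≤ t) :
    ∫⁻ x in Ioo 0 t, wt r x ≤ ENNReal.ofReal (1 / (r + 1)) * wt (r + 1) t := by
  have hd : ∀ x ∈ uIcc 0 t, HasDerivAt (fun t ↦ (1 + t) ^ (r + 1) / (r + 1)) ((1 + x) ^ r) x := by
    intro x hx
    rw [uIcc_of_le ht] at hx
    have h0 : 0 < 1 + x := by linarith [hx.1]
    have := ((hasDerivAt_id x).const_add 1).rpow_const (p := r + 1) (Or.inl h0.ne')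
    have hr' : r + 1 ≠ 0 := by linarith
    exact (this.div_const (r + 1)).congr_deriv (by simp [hr'])
  have hc : ContinuousOn (fun x : ℝ ↦ (1 + x) ^ r) (Icc 0 t) := fun x hx ↦
    (ContinuousAt.rpow_const (by fun_prop) (Or.inl (by have := hx.1; positivity))).continuousWithinAt
  have hi : IntervalIntegrable (fun x : ℝ ↦ (1 + x) ^ r) volume 0 t := by
    apply ContinuousOn.intervalIntegrable; rwa [uIcc_of_le ht]
  have h1 : ∫⁻ x in Ioo 0 t, wt r x = ∫⁻ x in Ioo 0 t, ENNReal.ofReal ((1 + x) ^ r) :=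
    setLIntegral_congr_fun measurableSet_Ioo fun x hx ↦ by
      rw [wt, abs_of_nonneg hx.1.le]
  rw [h1, ← ofReal_integral_eq_lintegral_ofReal
      (((intervalIntegrable_iff_integrableOn_Ioo_of_le ht).1 hi))
      (ae_restrict_of_forall_mem measurableSet_Ioo fun x hx ↦ by have := hx.1; positivity),
    ← integral_Ioc_eq_integral_Ioo, ← intervalIntegral.integral_of_le ht,
    intervalIntegral.integral_eq_sub_of_hasDerivAt hd hi, wt,
    ← ENNReal.ofReal_mul (by rw [one_div, inv_nonneg]; linarith), abs_of_nonneg ht]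
  refine ENNReal.ofReal_le_ofReal ?_
  have : 0 < r + 1 := by linarith
  rw [add_zero, Real.one_rpow, div_mul_eq_mul_div, one_mul, sub_le_self_iff]
  positivity

/-- Hardy's inequality for tails, with the weight `(1 + x) ^ a`. -/
lemma hardy {a : ℝ} (ha : 1 / 2 < a) : ∃ C : ℝ≥0∞, C ≠ ∞ ∧ ∀ F : ℝ → ℝ≥0∞, Measurable F →
    ∫⁻ x in Ioi (0 : ℝ), (wt (a - 1) x * ∫⁻ t in Ioi x, F t) ^ 2 ≤
      C * ∫⁻ t in Ioi (0 : ℝ), (wt a t * F t) ^ 2 := by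
  -- Cauchy–Schwarz is applied with the auxiliary weight `b`: `1/2 < b` makes `(1 + t)^(-2b)`
  -- integrable at infinity, and `b < a` gives `2a - 2b - 1 > -1`, as the inner integral after
  -- Tonelli requires.
  obtain ⟨b, hb1, hb2⟩ := exists_between ha
  refine ⟨ENNReal.ofReal (1 / (-(-2 * b) - 1)) * ENNReal.ofReal (1 / ((2 * a - 2 * b - 1) + 1)),
    by finiteness, fun F hF ↦ ?_⟩
  set c₁ := ENNReal.ofReal (1 / (-(-2 * b) - 1))
  set c₂ := ENNReal.ofReal (1 / ((2 * a - 2 * b - 1) + 1))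
  have sq (c x : ℝ) : wt c x ^ 2 = wt (2 * c) x := by rw [pow_two, wt_mul]; ring_nf
  have h1 : ∀ x ∈ Ioi (0 : ℝ), (wt (a - 1) x * ∫⁻ t in Ioi x, F t) ^ 2 ≤
      c₁ * ∫⁻ t in Ioi (0 : ℝ), (Ioi x).indicator (fun t ↦ wt (2 * a - 2 * b - 1) x * (wt b t * F t) ^ 2) t := by
    intro x hx
    have hx : 0 < x := hx
    rw [lintegral_indicator measurableSet_Ioi, Measure.restrict_restrict measurableSet_Ioi,
      inter_eq_self_of_subset_left (Ioi_subset_Ioi hx.le), lintegral_const_mul _ (by fun_prop),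
      mul_pow]
    calc wt (a - 1) x ^ 2 * (∫⁻ t in Ioi x, F t) ^ 2
        = wt (a - 1) x ^ 2 * (∫⁻ t in Ioi x, wt (-b) t * (wt b t * F t)) ^ 2 := by
          congr 3; funext t; rw [← mul_assoc, wt_mul]; simp
      _ ≤ wt (a - 1) x ^ 2 * ((∫⁻ t in Ioi x, wt (-b) t ^ 2) * ∫⁻ t in Ioi x, (wt b t * F t) ^ 2) := by
          gcongr
          exact sq_lintegral_mul_le _ (by fun_prop) (by fun_prop)
      _ = _ := by
          simp only [sq]
          have h2 : ∫⁻ t in Ioi x, wt (-2 * b) t = c₁ * wt (-2 * b + 1) x :=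
            lintegral_Ioi_wt (by linarith) hx.le
          have h3 : wt (2 * a - 2 * b - 1) x = wt (2 * (a - 1)) x * wt (-2 * b + 1) x := by
            rw [wt_mul]; ring_nf
          rw [show 2 * -b = -2 * b by ring, h2, h3]
          simp only [mul_pow, sq]
          ring
  refine (setLIntegral_mono' measurableSet_Ioi h1).trans ?_
  have hm : Measurable (Function.uncurry fun x t : ℝ ↦
      (Ioi x).indicator (fun t ↦ wt (2 * a - 2 * b - 1) x * (wt b t * F t) ^ 2) t) := by
    have : MeasurableSet {p : ℝ × ℝ | p.1 < p.2} := measurableSet_lt measurable_fst measurable_snd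
    have h2 : Measurable fun p : ℝ × ℝ ↦ wt (2 * a - 2 * b - 1) p.1 * (wt b p.2 * F p.2) ^ 2 := by
      fun_prop
    convert h2.indicator this using 1
    ext ⟨x, t⟩
    simp [indicator, Function.uncurry]
  rw [lintegral_const_mul _ (by exact hm.lintegral_prod_right), lintegral_lintegral_swap hm.aemeasurable, mul_assoc]
  gcongr
  rw [← lintegral_const_mul _ (by fun_prop)]
  refine setLIntegral_mono' measurableSet_Ioi fun t ht ↦ ?_
  have ht : 0 < t := ht
  calc ∫⁻ x in Ioi (0 : ℝ), (Ioi x).indicator (fun t ↦ wt (2 * a - 2 * b - 1) x * (wt b t * F t) ^ 2) t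
      = ∫⁻ x in Ioi (0 : ℝ), (Iio t).indicator (fun x ↦ wt (2 * a - 2 * b - 1) x * (wt b t * F t) ^ 2) x := by
        refine lintegral_congr fun x ↦ ?_
        simp [indicator]
    _ = (∫⁻ x in Ioo 0 t, wt (2 * a - 2 * b - 1) x) * (wt b t * F t) ^ 2 := by
        rw [lintegral_indicator measurableSet_Iio, Measure.restrict_restrict measurableSet_Iio,
          Iio_inter_Ioi, lintegral_mul_const _ (by fun_prop)]
    _ ≤ c₂ * wt (2 * a - 2 * b - 1 + 1) t * (wt b t * F t) ^ 2 := by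
        gcongr
        exact setLIntegral_Ioo_wt_le (by linarith) ht.le
    _ = _ := by
        rw [mul_pow, mul_pow, sq, sq, mul_assoc, ← mul_assoc (wt _ t), wt_mul]
        ring_nf

end Hardy
end Coarsening

/-! ### Laplace transforms, exponential tilting and convolution. -/

namespace Coarsening
open scoped ENNReal FourierTransform Convolution

/-- Measurable functions on `(0,∞)`, extended by zero, whose Laplace transform converges
absolutely in the open right half plane. -/
structure Lap (v : ℝ → ℝ) : Prop where
  meas : Measurable v
  supp : ∀ x ≤ 0, v x = 0
  int : ∀ s, 0 < s → Integrable fun x ↦ Real.exp (-(s * x)) * v x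

/-- The Laplace transform `∫ e^{-zx} v(x) dx`. -/
noncomputable def lap (v : ℝ → ℝ) (z : ℂ) : ℂ := ∫ x : ℝ, Complex.exp (-(z * x)) * (v x : ℂ)

lemma norm_cexp_mul (v : ℝ → ℝ) (z : ℂ) (x : ℝ) :
    ‖Complex.exp (-(z * x)) * (v x : ℂ)‖ = ‖Real.exp (-(z.re * x)) * v x‖ := by
  simp [Complex.norm_exp]

lemma integrable_cexp_mul_iff {v : ℝ → ℝ} (hv : Measurable v) (z : ℂ) :
    (Integrable fun x : ℝ ↦ Complex.exp (-(z * x)) * (v x : ℂ)) ↔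
      Integrable fun x : ℝ ↦ Real.exp (-(z.re * x)) * v x :=
  integrable_congr' (by fun_prop) (by fun_prop)
    (Filter.Eventually.of_forall fun x ↦ norm_cexp_mul v z x)

lemma Lap.integrable {v : ℝ → ℝ} (hv : Lap v) {z : ℂ} (hz : 0 < z.re) :
    Integrable fun x : ℝ ↦ Complex.exp (-(z * x)) * (v x : ℂ) :=
  (integrable_cexp_mul_iff hv.meas z).2 (hv.int _ hz)

lemma integrable_exp_mul_of_nonneg {v : ℝ → ℝ} (hm : Measurable v) (hs : ∀ x ≤ 0, v x = 0)
    (hi : Integrable v) {s : ℝ} (h : 0 ≤ s) : Integrable fun x ↦ Real.exp (-(s * x)) * v x := by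
  refine hi.mono (by fun_prop) (Filter.Eventually.of_forall fun x ↦ ?_)
  rw [norm_mul, Real.norm_eq_abs, Real.abs_exp]
  rcases le_or_gt x 0 with hx | hx
  · simp [hs x hx]
  · exact mul_le_of_le_one_left (norm_nonneg _) (by rw [Real.exp_le_one_iff]; nlinarith)

lemma integrable_cexp_mul_of_nonneg {v : ℝ → ℝ} (hm : Measurable v) (hs : ∀ x ≤ 0, v x = 0)
    (hi : Integrable v) {z : ℂ} (hz : 0 ≤ z.re) :
    Integrable fun x : ℝ ↦ Complex.exp (-(z * x)) * (v x : ℂ) :=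
  (integrable_cexp_mul_iff hm z).2 (integrable_exp_mul_of_nonneg hm hs hi hz)

lemma Lap.of_integrable {v : ℝ → ℝ} (hm : Measurable v) (hs : ∀ x ≤ 0, v x = 0)
    (hi : Integrable v) : Lap v :=
  ⟨hm, hs, fun _ h ↦ integrable_exp_mul_of_nonneg hm hs hi h.le⟩

lemma Lap.add {u v : ℝ → ℝ} (hu : Lap u) (hv : Lap v) : Lap fun x ↦ u x + v x :=
  ⟨hu.meas.add hv.meas, fun x hx ↦ by simp [hu.supp x hx, hv.supp x hx], fun s hs ↦ by
    simp only [mul_add]; exact (hu.int s hs).add (hv.int s hs)⟩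

lemma Lap.sub {u v : ℝ → ℝ} (hu : Lap u) (hv : Lap v) : Lap fun x ↦ u x - v x :=
  ⟨hu.meas.sub hv.meas, fun x hx ↦ by simp [hu.supp x hx, hv.supp x hx], fun s hs ↦ by
    simp only [mul_sub]; exact (hu.int s hs).sub (hv.int s hs)⟩

lemma Lap.const_mul {v : ℝ → ℝ} (hv : Lap v) (c : ℝ) : Lap fun x ↦ c * v x :=
  ⟨hv.meas.const_mul c, fun x hx ↦ by simp [hv.supp x hx], fun s hs ↦ by
    simpa only [mul_left_comm] using (hv.int s hs).const_mul c⟩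

lemma lap_add {u v : ℝ → ℝ} (hu : Lap u) (hv : Lap v) {z : ℂ} (hz : 0 < z.re) :
    lap (fun x ↦ u x + v x) z = lap u z + lap v z := by
  rw [lap, lap, lap, ← integral_add (hu.integrable hz) (hv.integrable hz)]
  simp [mul_add]

lemma lap_sub {u v : ℝ → ℝ} (hu : Lap u) (hv : Lap v) {z : ℂ} (hz : 0 < z.re) :
    lap (fun x ↦ u x - v x) z = lap u z - lap v z := by
  rw [lap, lap, lap, ← integral_sub (hu.integrable hz) (hv.integrable hz)]
  simp [mul_sub]

lemma lap_const_mul (v : ℝ → ℝ) (c : ℝ) (z : ℂ) : lap (fun x ↦ c * v x) z = c * lap v z := by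
  rw [lap, lap, ← integral_const_mul]
  simp [mul_left_comm]

/-- Exponential tilting. -/
noncomputable def tilt (s : ℝ) (v : ℝ → ℝ) (x : ℝ) : ℝ := Real.exp (-(s * x)) * v x

lemma Lap.tilt {v : ℝ → ℝ} (hv : Lap v) {s : ℝ} (hs : 0 ≤ s) : Lap (tilt s v) :=
  ⟨by have := hv.meas; unfold Coarsening.tilt; fun_prop, fun x hx ↦ by simp [Coarsening.tilt, hv.supp x hx],
    fun t ht ↦ by
    convert hv.int (t + s) (by positivity) using 2 with x
    rw [Coarsening.tilt, ← mul_assoc, ← Real.exp_add]; ring_nf⟩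

lemma lap_tilt (v : ℝ → ℝ) (s : ℝ) (z : ℂ) : lap (tilt s v) z = lap v (z + s) := by
  refine integral_congr_ae (Filter.Eventually.of_forall fun x ↦ ?_)
  simp only [tilt]
  push_cast
  rw [← mul_assoc, ← Complex.exp_add]; ring_nf

lemma fourier_tilt (v : ℝ → ℝ) (s t : ℝ) :
    𝓕 (fun x ↦ (tilt s v x : ℂ)) t = lap v (s + 2 * Real.pi * t * Complex.I) := by
  rw [Real.fourier_eq', lap]
  refine integral_congr_ae (Filter.Eventually.of_forall fun x ↦ ?_)
  simp only [tilt, smul_eq_mul]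
  push_cast
  rw [← mul_assoc, ← Complex.exp_add]
  congr 2
  simp
  ring

/-- Laplace transforms determine functions. -/
lemma Lap.ae_eq {u v : ℝ → ℝ} (hu : Lap u) (hv : Lap v)
    (h : ∀ z : ℂ, 0 < z.re → lap u z = lap v z) : u =ᵐ[volume] v := by
  have hd := hu.sub hv
  have h1 := ae_eq_zero_of_fourier_eq_zero (a := fun x ↦ ((Coarsening.tilt 1 fun x ↦ u x - v x) x : ℂ))
    (hd.int 1 one_pos).ofReal fun t ↦ by
      have hz : 0 < ((1 : ℝ) + 2 * Real.pi * t * Complex.I : ℂ).re := by simp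
      rw [fourier_tilt, lap_sub hu hv hz, h _ hz, sub_self]
  filter_upwards [h1] with x hx
  simpa [Coarsening.tilt, sub_eq_zero] using hx

/-- Convolution of real functions. -/
noncomputable def conv (a b : ℝ → ℝ) (x : ℝ) : ℝ := ∫ t, a t * b (x - t)

lemma measurable_conv {a b : ℝ → ℝ} (ha : Measurable a) (hb : Measurable b) :
    Measurable (conv a b) := by
  have : StronglyMeasurable (Function.uncurry fun x t ↦ a t * b (x - t)) :=
    Measurable.stronglyMeasurable (by simp only [Function.uncurry_def]; fun_prop)
  exact this.integral_prod_right.measurable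

lemma conv_eq_zero {a b : ℝ → ℝ} {r : ℝ} (ha : ∀ x ≤ r, a x = 0) (hb : ∀ x ≤ 0, b x = 0) :
    ∀ x ≤ r, conv a b x = 0 := by
  intro x hx
  rw [conv, ← integral_zero ℝ ℝ (μ := volume)]
  congr 1 with t
  rcases le_or_gt t r with h | h
  · simp [ha t h]
  · simp [hb (x - t) (by linarith)]

lemma tilt_conv (s : ℝ) (a b : ℝ → ℝ) : tilt s (conv a b) = conv (tilt s a) (tilt s b) := by
  funext x
  simp only [tilt, conv]
  rw [← integral_const_mul]
  congr 1 with t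
  rw [mul_mul_mul_comm, ← Real.exp_add]; ring_nf

lemma integrable_conv {a b : ℝ → ℝ} (ha : Integrable a) (hb : Integrable b) :
    Integrable (conv a b) :=
  ha.integrable_convolution (ContinuousLinearMap.mul ℝ ℝ) hb

lemma Lap.conv {a b : ℝ → ℝ} (ha : Lap a) (hb : Lap b) : Lap (conv a b) :=
  ⟨measurable_conv ha.meas hb.meas, conv_eq_zero ha.supp hb.supp, fun s hs ↦ by
    change Integrable (Coarsening.tilt s (Coarsening.conv a b))
    rw [tilt_conv]
    exact integrable_conv (ha.int s hs) (hb.int s hs)⟩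

lemma lap_conv_of_integrable {a b : ℝ → ℝ} {z : ℂ}
    (ha : Integrable fun x : ℝ ↦ Complex.exp (-(z * x)) * (a x : ℂ))
    (hb : Integrable fun x : ℝ ↦ Complex.exp (-(z * x)) * (b x : ℂ)) :
    lap (Coarsening.conv a b) z = lap a z * lap b z := by
  have := integral_convolution (μ := volume) (ν := volume) (ContinuousLinearMap.mul ℝ ℂ) ha hb
  rw [ContinuousLinearMap.mul_apply'] at this
  rw [lap, lap, lap, ← this]
  refine integral_congr_ae (Filter.Eventually.of_forall fun x ↦ ?_)
  simp only [Coarsening.conv, convolution_def, ContinuousLinearMap.mul_apply']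
  rw [← integral_complex_ofReal, ← integral_const_mul]
  congr 1 with t
  rw [mul_mul_mul_comm, ← Complex.exp_add]
  push_cast
  ring_nf

lemma lap_conv {a b : ℝ → ℝ} (ha : Lap a) (hb : Lap b) {z : ℂ} (hz : 0 < z.re) :
    lap (Coarsening.conv a b) z = lap a z * lap b z :=
  lap_conv_of_integrable (ha.integrable hz) (hb.integrable hz)

section norms

lemma enorm_conv_le (a b : ℝ → ℝ) (x : ℝ) :
    ‖conv a b x‖ₑ ≤ ((fun t ↦ ‖a t‖ₑ) ⋆ₗ fun t ↦ ‖b t‖ₑ) x := by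
  rw [lconvolution_def]
  refine (enorm_integral_le_lintegral_enorm _).trans_eq ?_
  simp [enorm_mul, sub_eq_neg_add]

lemma nrm_conv_le {c : ℝ} (hc : 0 ≤ c) {a b : ℝ → ℝ} (ha : Measurable a) (hb : Measurable b) :
    nrm c (conv a b) ≤ nrm c a * nrm c b := by
  rw [nrm, nrm, nrm, ← lintegral_lconvolution (by fun_prop) (by fun_prop)]
  refine lintegral_mono fun x ↦ ?_
  refine (mul_le_mul_right (enorm_conv_le a b x) _).trans ?_
  rw [lconvolution_def, lconvolution_def, ← lintegral_const_mul _ (by fun_prop)]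
  refine lintegral_mono fun y ↦ ?_
  calc _ = wt c (y + (-y + x)) * (‖a y‖ₑ * ‖b (-y + x)‖ₑ) := by simp
    _ ≤ (wt c y * wt c (-y + x)) * (‖a y‖ₑ * ‖b (-y + x)‖ₑ) := by gcongr; exact wt_add_le hc _ _
    _ = _ := by ring

/-- Negative `c` is allowed because `γ - 2` may be negative. For functions living on `(0,∞)` a
decreasing weight at `x + y` is at most its value at `y`, so the first factor then needs no weight.
-/
lemma sqn_conv_le {c : ℝ} {a b : ℝ → ℝ} (ha : Measurable a) (hb : Measurable b)
    (ha0 : ∀ x ≤ 0, a x = 0) (hb0 : ∀ x ≤ 0, b x = 0) :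
    sqn c (conv a b) ≤ nrm (max c 0) a ^ 2 * sqn c b := by
  rw [sqn, nrm, sqn]
  refine (lintegral_mono fun x ↦ ?_).trans (lintegral_lconvolution_sq_le (by fun_prop) (by fun_prop))
  gcongr
  refine (mul_le_mul_right (enorm_conv_le a b x) _).trans ?_
  rw [lconvolution_def, lconvolution_def, ← lintegral_const_mul _ (by fun_prop)]
  refine lintegral_mono fun y ↦ ?_
  simp only
  rcases le_or_gt y 0 with h1 | h1
  · simp [ha0 y h1]
  rcases le_or_gt (-y + x) 0 with h2 | h2
  · simp [hb0 _ h2]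
  calc _ = wt c (y + (-y + x)) * (‖a y‖ₑ * ‖b (-y + x)‖ₑ) := by simp
    _ ≤ (wt (max c 0) y * wt c (-y + x)) * (‖a y‖ₑ * ‖b (-y + x)‖ₑ) := by
      gcongr
      rcases le_total c 0 with hc | hc
      · rw [max_eq_right hc, wt_zero, one_mul]; exact wt_add_le_of_nonpos hc h1.le h2.le
      · rw [max_eq_left hc]; exact wt_add_le hc _ _
    _ = _ := by ring

/-- The weight of a sum is controlled by the sum of the weights, so only one factor at a time
carries it and the other needs only to be integrable. Hence densities in `L²_γ` stay there under
convolution with no loss in `γ`. -/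
lemma sqn_conv_lt_top {c : ℝ} (hc : 0 ≤ c) {a b : ℝ → ℝ} (ha : Measurable a) (hb : Measurable b)
    (ha1 : nrm 0 a < ∞) (hb1 : nrm 0 b < ∞) (ha2 : sqn c a < ∞) (hb2 : sqn c b < ∞) :
    sqn c (conv a b) < ∞ := by
  set A : ℝ → ℝ≥0∞ := fun x ↦ ‖a x‖ₑ with hA
  set B : ℝ → ℝ≥0∞ := fun x ↦ ‖b x‖ₑ with hB
  set A' : ℝ → ℝ≥0∞ := fun x ↦ wt c x * ‖a x‖ₑ with hA'
  set B' : ℝ → ℝ≥0∞ := fun x ↦ wt c x * ‖b x‖ₑ with hB'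
  have mA : Measurable A := by fun_prop
  have mB : Measurable B := by fun_prop
  have mA' : Measurable A' := by fun_prop
  have mB' : Measurable B' := by fun_prop
  have h1 : ∀ x, wt c x * ‖conv a b x‖ₑ ≤ ENNReal.ofReal (2 ^ c) * ((A ⋆ₗ B') x + (B ⋆ₗ A') x) := by
    intro x
    refine (mul_le_mul_right (enorm_conv_le a b x) _).trans ?_
    rw [lconvolution_comm (f := B), lconvolution_def, lconvolution_def, lconvolution_def,
      ← lintegral_add_left (by fun_prop), ← lintegral_const_mul _ (by fun_prop),
      ← lintegral_const_mul _ (by fun_prop)]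
    refine lintegral_mono fun y ↦ ?_
    calc _ = wt c (y + (-y + x)) * (‖a y‖ₑ * ‖b (-y + x)‖ₑ) := by simp
      _ ≤ (ENNReal.ofReal (2 ^ c) * (wt c y + wt c (-y + x))) * (‖a y‖ₑ * ‖b (-y + x)‖ₑ) := by
        gcongr; exact wt_add_le_add hc _ _
      _ = _ := by simp only [hA, hB, hA', hB']; ring
  have h2 : ∀ x, (wt c x * ‖conv a b x‖ₑ) ^ 2 ≤
      ENNReal.ofReal (2 ^ c) ^ 2 * (2 * (A ⋆ₗ B') x ^ 2 + 2 * (B ⋆ₗ A') x ^ 2) := by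
    intro x
    refine (pow_le_pow_left' (h1 x) 2).trans ?_
    rw [mul_pow, ← mul_add]
    gcongr
    have := ENNReal.rpow_add_le_mul_rpow_add_rpow ((A ⋆ₗ B') x) ((B ⋆ₗ A') x)
      (p := 2) (by norm_num)
    norm_num at this
    exact this
  refine (lintegral_mono h2).trans_lt ?_
  have m1 : Measurable (A ⋆ₗ B') := measurable_lconvolution _ mA mB'
  have m2 : Measurable (B ⋆ₗ A') := measurable_lconvolution _ mB mA'
  rw [lintegral_const_mul _ (by fun_prop), lintegral_add_left (by fun_prop),
    lintegral_const_mul _ (by fun_prop), lintegral_const_mul _ (by fun_prop)]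
  have b1 := (lintegral_lconvolution_sq_le mA mB').trans_lt
    (ENNReal.mul_lt_top (ENNReal.pow_lt_top (by simpa [nrm] using ha1)) hb2)
  have b2 := (lintegral_lconvolution_sq_le mB mA').trans_lt
    (ENNReal.mul_lt_top (ENNReal.pow_lt_top (by simpa [nrm] using hb1)) ha2)
  finiteness

lemma integrable_of_nrm {v : ℝ → ℝ} (hv : Measurable v) (h : nrm 0 v < ∞) : Integrable v :=
  ⟨hv.aestronglyMeasurable, by simpa [nrm, HasFiniteIntegral] using h⟩

lemma nrm_zero_lt_top {v : ℝ → ℝ} (h : Integrable v) : nrm 0 v < ∞ := by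
  simpa [nrm, HasFiniteIntegral] using h.hasFiniteIntegral

end norms
end Coarsening

/-! ### A Wiener lemma with weights: decay of the resolvent kernel. -/

namespace Coarsening
open scoped ENNReal FourierTransform

lemma exists_lintegral_one_sub_exp {p : ℕ} {α : ℝ} (h0 : 0 < α) (hp : α < p) :
    ∃ c : ℝ≥0∞, c ≠ 0 ∧ c ≠ ∞ ∧ ∀ W : ℝ → ℝ≥0∞, Measurable W → (∀ x ≤ 0, W x = 0) →
      ∫⁻ h in Ioi (0 : ℝ), ENNReal.ofReal (h ^ (-1 - α)) *
        ∫⁻ x, W x * ENNReal.ofReal (1 - Real.exp (-(h * x))) ^ p =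
      c * ∫⁻ x, W x * ENNReal.ofReal (x ^ α) := by
  obtain ⟨c, c0, ct, hc⟩ := lintegral_one_sub_exp_pow h0 hp
  refine ⟨c, c0, ct, fun W hW hW0 ↦ ?_⟩
  simp_rw [← lintegral_const_mul' _ _ ENNReal.ofReal_ne_top]
  rw [lintegral_lintegral_swap (by fun_prop), ← lintegral_const_mul _ (by fun_prop)]
  refine lintegral_congr fun x ↦ ?_
  rcases le_or_gt x 0 with hx | hx
  · simp [hW0 x hx]
  · rw [mul_left_comm, ← hc x hx, ← lintegral_const_mul _ (by fun_prop)]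
    refine lintegral_congr fun h ↦ ?_
    ring

lemma wt_le_one_add {α x : ℝ} (hα : 0 ≤ α) (hx : 0 < x) :
    wt α x ≤ ENNReal.ofReal (2 ^ α) * (1 + ENNReal.ofReal (x ^ α)) := by
  rw [← ENNReal.ofReal_one, ← ENNReal.ofReal_add zero_le_one (by positivity),
    ← ENNReal.ofReal_mul (by positivity)]
  refine ENNReal.ofReal_le_ofReal ?_
  rw [abs_of_pos hx]
  rcases le_total x 1 with h | h
  · calc (1 + x) ^ α ≤ 2 ^ α := by gcongr; linarith
      _ ≤ _ := le_mul_of_one_le_right (by positivity) (by linarith [Real.rpow_nonneg hx.le α])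
  · calc (1 + x) ^ α ≤ (2 * x) ^ α := by gcongr; linarith
      _ = 2 ^ α * x ^ α := Real.mul_rpow (by norm_num) hx.le
      _ ≤ _ := by gcongr; linarith

lemma ofReal_rpow_le_wt {α x : ℝ} (hα : 0 ≤ α) (hx : 0 < x) : ENNReal.ofReal (x ^ α) ≤ wt α x :=
  ENNReal.ofReal_le_ofReal (Real.rpow_le_rpow hx.le (by rw [abs_of_pos hx]; linarith) hα)

lemma enorm_tilt_le {v : ℝ → ℝ} (h0 : ∀ x ≤ 0, v x = 0) {s : ℝ} (hs : 0 ≤ s) (x : ℝ) :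
    ‖tilt s v x‖ₑ ≤ ‖v x‖ₑ := by
  rcases le_or_gt x 0 with hx | hx
  · simp [tilt, h0 x hx]
  · rw [tilt, enorm_mul]
    refine mul_le_of_le_one_left' ?_
    rw [Real.enorm_of_nonneg (Real.exp_nonneg _), ENNReal.ofReal_le_one, Real.exp_le_one_iff]
    have := mul_nonneg hs hx.le
    linarith

lemma enorm_tilt_sub_tilt {v : ℝ → ℝ} (h0 : ∀ x ≤ 0, v x = 0) (s : ℝ) {h : ℝ} (hh : 0 ≤ h) (x : ℝ) :
    ‖tilt s v x - tilt (s + h) v x‖ₑ =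
      ‖tilt s v x‖ₑ * ENNReal.ofReal (1 - Real.exp (-(h * x))) := by
  rcases le_or_gt x 0 with hx | hx
  · simp [tilt, h0 x hx]
  · have : tilt s v x - tilt (s + h) v x = tilt s v x * (1 - Real.exp (-(h * x))) := by
      have e : Real.exp (-((s + h) * x)) = Real.exp (-(s * x)) * Real.exp (-(h * x)) := by
        rw [← Real.exp_add]; ring_nf
      simp only [tilt, e]; ring
    rw [this, enorm_mul, Real.enorm_of_nonneg (r := 1 - _)]
    have := mul_nonneg hh hx.le
    simpa using this

lemma tilt_zero (v : ℝ → ℝ) : tilt 0 v = v := by funext x; simp [tilt]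

lemma memLp_of_sqn {v : ℝ → ℝ} (hv : Measurable v) (h : sqn 0 v < ∞) :
    MemLp (fun x ↦ (v x : ℂ)) 2 := by
  refine ⟨by fun_prop, ?_⟩
  rw [eLpNorm_lt_top_iff_lintegral_rpow_enorm_lt_top (by norm_num) (by norm_num)]
  simpa [sqn, ← ofReal_norm] using h

lemma sqn_tilt_le {b : ℝ} {v : ℝ → ℝ} (h0 : ∀ x ≤ 0, v x = 0) {s : ℝ} (hs : 0 ≤ s) :
    sqn b (tilt s v) ≤ sqn b v :=
  lintegral_mono fun x ↦ by gcongr; exact enorm_tilt_le h0 hs x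

lemma nrm_tilt_le {b : ℝ} {v : ℝ → ℝ} (h0 : ∀ x ≤ 0, v x = 0) {s : ℝ} (hs : 0 ≤ s) :
    nrm b (tilt s v) ≤ nrm b v :=
  lintegral_mono fun x ↦ by gcongr; exact enorm_tilt_le h0 hs x

/-- Fatou as `s → 0`. It lets Plancherel be used only for `s > 0`, where integrability of the tilted
function is known in advance. -/
lemma sqn_le_of_tilt {b : ℝ} {v : ℝ → ℝ} (hv : Measurable v) {M : ℝ≥0∞}
    (h : ∀ s > 0, sqn b (tilt s v) ≤ M) : sqn b v ≤ M := by
  have hm (s : ℝ) : Measurable (tilt s v) := by unfold tilt; fun_prop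
  have key : ∀ x, Filter.liminf (fun n : ℕ ↦ (wt b x * ‖tilt (1 / ((n : ℝ) + 1)) v x‖ₑ) ^ 2) Filter.atTop =
      (wt b x * ‖v x‖ₑ) ^ 2 := by
    intro x
    refine Filter.Tendsto.liminf_eq ?_
    have h1 : Filter.Tendsto (fun n : ℕ ↦ tilt (1 / ((n : ℝ) + 1)) v x) Filter.atTop (nhds (v x)) := by
      have h2 : Continuous fun s ↦ tilt s v x := by unfold tilt; fun_prop
      have := (h2.tendsto 0).comp tendsto_one_div_add_atTop_nhds_zero_nat
      rwa [tilt_zero] at this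
    exact (ENNReal.continuous_pow 2).continuousAt.tendsto.comp
      (ENNReal.Tendsto.const_mul (continuous_enorm.continuousAt.tendsto.comp h1)
        (Or.inr (wt_ne_top b x)))
  rw [sqn]
  simp_rw [← key]
  refine (lintegral_liminf_le fun n ↦ by have := hm (1 / ((n : ℝ) + 1)); fun_prop).trans ?_
  refine (Filter.liminf_le_liminf (Filter.Eventually.of_forall fun n : ℕ ↦
    h (1 / ((n : ℝ) + 1)) Nat.one_div_pos_of_nat)).trans ?_
  simp

/-- `k` is the resolvent of `f`, i.e. `1 + k̂ = 1 / (1 - f̂)`, where `1 - f̂` is bounded away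
from zero in the right half plane. -/
structure IsResolvent (f k : ℝ → ℝ) : Prop where
  left : Lap f
  right : Lap k
  sqn_tilt : ∀ s, 0 < s → sqn 0 (tilt s k) < ∞
  bound : ∃ c : ℝ, 0 < c ∧ ∀ z : ℂ, 0 < z.re → c ≤ ‖1 - lap f z‖
  eq : ∀ z : ℂ, 0 < z.re → lap k z * (1 - lap f z) = lap f z

namespace IsResolvent

variable {f k : ℝ → ℝ}

/-- Plancherel on vertical lines, using `k̂ = f̂ / (1 - f̂)` and `k̂(z) - k̂(z') = (f̂(z) - f̂(z'))
/ ((1 - f̂(z))(1 - f̂(z')))`. With `c` the lower bound for `|1 - f̂|`, the factors are `1/c` and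
`1/c²`. The constant does not depend on `s` or `d`. -/
lemma sqn_bounds (h : IsResolvent f k) (hf : sqn 0 f < ∞) :
    ∃ C : ℝ≥0∞, C ≠ ∞ ∧ (∀ s, 0 < s → ∫⁻ x, ‖tilt s k x‖ₑ ^ 2 ≤ C * ∫⁻ x, ‖tilt s f x‖ₑ ^ 2) ∧
      ∀ s, 0 < s → ∀ d, 0 < d → ∫⁻ x, ‖tilt s k x - tilt (s + d) k x‖ₑ ^ 2 ≤
        C * ∫⁻ x, ‖tilt s f x - tilt (s + d) f x‖ₑ ^ 2 := by
  obtain ⟨c, c0, hc⟩ := h.bound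
  have hfs (s : ℝ) (hs : 0 < s) : sqn 0 (tilt s f) < ∞ := (sqn_tilt_le h.left.supp hs.le).trans_lt hf
  have mk (s : ℝ) (hs : 0 < s) := (h.right.tilt hs.le).meas
  have mf (s : ℝ) (hs : 0 < s) := (h.left.tilt hs.le).meas
  have e (v : ℝ → ℝ) : ∫⁻ x, ‖v x‖ₑ ^ 2 = ∫⁻ x, ‖((v x : ℝ) : ℂ)‖ₑ ^ 2 := by
    simp [← ofReal_norm]
  refine ⟨ENNReal.ofReal c⁻¹ ^ 2 + ENNReal.ofReal (c⁻¹ * c⁻¹) ^ 2, by finiteness, fun s hs ↦ ?_,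
    fun s hs d hd ↦ ?_⟩
  · refine le_trans ?_ (mul_le_mul_left le_self_add _)
    rw [e, e]
    refine lintegral_enorm_sq_le_of_fourier (h.right.int s hs).ofReal
      (memLp_of_sqn (mk s hs) (h.sqn_tilt s hs)) (h.left.int s hs).ofReal
      (memLp_of_sqn (mf s hs) (hfs s hs)) fun t ↦ ?_
    have hz : 0 < ((s : ℂ) + 2 * Real.pi * t * Complex.I).re := by simpa using hs
    change ‖𝓕 (fun x ↦ (tilt s k x : ℂ)) t‖ ≤ c⁻¹ * ‖𝓕 (fun x ↦ (tilt s f x : ℂ)) t‖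
    rw [fourier_tilt, fourier_tilt, ← h.eq _ hz, norm_mul]
    rw [le_inv_mul_iff₀ c0, mul_comm]
    gcongr
    exact hc _ hz
  · have hsd : 0 < s + d := by positivity
    have dk := h.right.tilt hs.le |>.sub (h.right.tilt hsd.le)
    have df := h.left.tilt hs.le |>.sub (h.left.tilt hsd.le)
    refine le_trans ?_ (mul_le_mul_left le_add_self _)
    rw [e fun x ↦ tilt s k x - tilt (s + d) k x, e fun x ↦ tilt s f x - tilt (s + d) f x]
    have L1 {v : ℝ → ℝ} (hv : Lap v) : Integrable fun x ↦ ((tilt s v x - tilt (s + d) v x : ℝ) : ℂ) :=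
      ((hv.int s hs).sub (hv.int (s + d) hsd)).ofReal
    have L2 {v : ℝ → ℝ} (hv : Lap v) (h2 : ∀ s, 0 < s → sqn 0 (tilt s v) < ∞) :
        MemLp (fun x ↦ ((tilt s v x - tilt (s + d) v x : ℝ) : ℂ)) 2 := by
      simpa using! (memLp_of_sqn (hv.tilt hs.le).meas (h2 s hs)).sub
        (memLp_of_sqn (hv.tilt hsd.le).meas (h2 _ hsd))
    have F {v : ℝ → ℝ} (hv : Lap v) (t : ℝ) :
        𝓕 (fun x ↦ ((tilt s v x - tilt (s + d) v x : ℝ) : ℂ)) t =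
        lap v (s + 2 * Real.pi * t * Complex.I) - lap v ((s + d : ℝ) + 2 * Real.pi * t * Complex.I) := by
      rw [← fourier_tilt, ← fourier_tilt, Real.fourier_eq, Real.fourier_eq, Real.fourier_eq,
        ← integral_sub]
      · simp [smul_sub]
      · simpa using (Real.fourierIntegral_convergent_iff t).2 (hv.int s hs).ofReal
      · simpa using (Real.fourierIntegral_convergent_iff t).2 (hv.int (s + d) hsd).ofReal
    refine lintegral_enorm_sq_le_of_fourier (L1 h.right) (L2 h.right h.sqn_tilt) (L1 h.left)
      (L2 h.left hfs) fun t ↦ ?_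
    rw [F h.right, F h.left]
    have hz : 0 < ((s : ℂ) + 2 * Real.pi * t * Complex.I).re := by simpa using hs
    have hz' : 0 < (((s + d : ℝ) : ℂ) + 2 * Real.pi * t * Complex.I).re := by simpa using hsd
    generalize (s : ℂ) + 2 * Real.pi * t * Complex.I = z at hz
    generalize ((s + d : ℝ) : ℂ) + 2 * Real.pi * t * Complex.I = z' at hz'
    have e1 := h.eq z hz
    have e2 := h.eq z' hz'
    have b1 := hc z hz
    have b2 := hc z' hz'
    have : (lap k z - lap k z') * ((1 - lap f z) * (1 - lap f z')) = lap f z - lap f z' := by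
      linear_combination (1 - lap f z') * e1 - (1 - lap f z) * e2
    rw [← this, norm_mul, norm_mul, ← mul_inv, le_inv_mul_iff₀ (by positivity), mul_comm]
    gcongr

/-- The resolvent of an integrable kernel of polynomial decay is integrable. -/
lemma nrm_zero_lt_top (h : IsResolvent f k) {β : ℝ} (hβ : 1 / 2 < β) (hf : sqn β f < ∞) :
    nrm 0 k < ∞ := by
  -- The scaling integral below has `p = 2` and `α = 2 * β`, so it converges only for `β < 1`. Any
  -- exponent in `(1/2, 1)` suffices for integrability.
  wlog hβ1 : β < 1 generalizing β
  · exact this (β := 3 / 4) (by norm_num) ((sqn_mono (by linarith) f).trans_lt hf) (by norm_num)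
  have hf0 : sqn 0 f < ∞ := (sqn_mono (by linarith) f).trans_lt hf
  obtain ⟨C, hC, hA, hB⟩ := h.sqn_bounds hf0
  refine nrm_lt_top_of_sqn (b := β) (by linarith) h.right.meas ?_
  obtain ⟨c, c0, ct, hc⟩ := exists_lintegral_one_sub_exp (p := 2) (α := 2 * β) (by linarith)
    (by push_cast; linarith)
  have key : ∀ s, 0 < s → ∫⁻ x, ‖tilt s k x‖ₑ ^ 2 * ENNReal.ofReal (x ^ (2 * β)) ≤
      C * ∫⁻ x, ‖tilt s f x‖ₑ ^ 2 * ENNReal.ofReal (x ^ (2 * β)) := by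
    intro s hs
    have mk := (h.right.tilt hs.le).meas
    have mf := (h.left.tilt hs.le).meas
    rw [← ENNReal.mul_le_mul_iff_right c0 ct, mul_left_comm, ← hc _ (by fun_prop)
      (fun x hx ↦ by simp [(h.right.tilt hs.le).supp x hx]), ← hc _ (by fun_prop)
      (fun x hx ↦ by simp [(h.left.tilt hs.le).supp x hx]), ← lintegral_const_mul' _ _ hC]
    refine setLIntegral_mono' measurableSet_Ioi fun d hd ↦ ?_
    have hd : 0 < d := hd
    rw [mul_left_comm]
    gcongr
    have := hB s hs d hd
    simp_rw [enorm_tilt_sub_tilt h.left.supp s hd.le, enorm_tilt_sub_tilt h.right.supp s hd.le,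
      mul_pow] at this
    exact this
  have bound : ∀ s > 0, sqn β (tilt s k) ≤ ENNReal.ofReal (2 ^ (2 * β)) * (C * sqn 0 f + C * sqn β f) := by
    intro s hs
    have mk := (h.right.tilt hs.le).meas
    have sq (x : ℝ) : wt β x ^ 2 = wt (2 * β) x := by rw [pow_two, wt_mul]; ring_nf
    calc sqn β (tilt s k) ≤ ∫⁻ x, ENNReal.ofReal (2 ^ (2 * β)) *
          (‖tilt s k x‖ₑ ^ 2 + ‖tilt s k x‖ₑ ^ 2 * ENNReal.ofReal (x ^ (2 * β))) := by
          refine lintegral_mono fun x ↦ ?_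
          rcases le_or_gt x 0 with hx | hx
          · simp [(h.right.tilt hs.le).supp x hx]
          · rw [mul_pow, sq]
            calc _ ≤ ENNReal.ofReal (2 ^ (2 * β)) * (1 + ENNReal.ofReal (x ^ (2 * β))) *
                  ‖tilt s k x‖ₑ ^ 2 := by gcongr; exact wt_le_one_add (by linarith) hx
              _ = _ := by ring
      _ = ENNReal.ofReal (2 ^ (2 * β)) * ((∫⁻ x, ‖tilt s k x‖ₑ ^ 2) +
          ∫⁻ x, ‖tilt s k x‖ₑ ^ 2 * ENNReal.ofReal (x ^ (2 * β))) := by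
          rw [lintegral_const_mul _ (by fun_prop), lintegral_add_left (by fun_prop)]
      _ ≤ _ := by
          gcongr
          · refine (hA s hs).trans ?_
            gcongr
            simpa [sqn] using sqn_tilt_le (b := 0) h.left.supp hs.le
          · refine (key s hs).trans ?_
            gcongr
            refine lintegral_mono fun x ↦ ?_
            rcases le_or_gt x 0 with hx | hx
            · simp [(h.left.tilt hs.le).supp x hx]
            · rw [mul_pow, sq, mul_comm]
              gcongr
              · exact ofReal_rpow_le_wt (by linarith) hx
              · exact enorm_tilt_le h.left.supp hs.le x
  refine (sqn_le_of_tilt h.right.meas bound).trans_lt ?_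
  finiteness

/-- The second resolvent identity `(1 + k) - (1 + k') = (1 + k) ⋆ (f - f') ⋆ (1 + k')`, where the
prime denotes the tilt by `d`, multiplied out so that no delta mass appears. -/
lemma sub_tilt_ae_eq (h : IsResolvent f k) {d : ℝ} (hd : 0 ≤ d) :
    (fun x ↦ k x - tilt d k x) =ᵐ[volume]
      fun x ↦ ((f x - tilt d f x) + conv k (fun x ↦ f x - tilt d f x) x) +
        (conv (fun x ↦ f x - tilt d f x) (tilt d k) x +
          conv k (conv (fun x ↦ f x - tilt d f x) (tilt d k)) x) := by
  have hk := h.right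
  have hk' := h.right.tilt hd
  have hf' := h.left.tilt hd
  have hD := h.left.sub hf'
  refine (hk.sub hk').ae_eq ((hD.add (hk.conv hD)).add ((hD.conv hk').add (hk.conv (hD.conv hk'))))
    fun z hz ↦ ?_
  have hz' : 0 < (z + d).re := by simp; positivity
  rw [lap_sub hk hk' hz, lap_add (hD.add (hk.conv hD)) ((hD.conv hk').add (hk.conv (hD.conv hk'))) hz,
    lap_add hD (hk.conv hD) hz, lap_add (hD.conv hk') (hk.conv (hD.conv hk')) hz,
    lap_conv hk (hD.conv hk') hz, lap_conv hD hk' hz, lap_conv hk hD hz, lap_sub h.left hf' hz,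
    lap_tilt, lap_tilt]
  linear_combination (1 + lap k (z + d)) * h.eq z hz - (1 + lap k z) * h.eq (z + d) hz'

/-- Since `k` already lies in the weighted convolution algebra, the resolvent identity bounds the
norm of `k - tilt d k` by `(1 + nrm c k)²` times that of `f - tilt d f`. Integrating against
`d^(-1-θ)` converts this into the extra weight `x^θ`; convergence with `p = 1` forces `θ < 1`. -/
lemma nrm_lt_top_step (h : IsResolvent f k) {c θ : ℝ} (hc : 0 ≤ c) (hθ : 0 < θ) (hθ1 : θ < 1)
    (hk : nrm c k < ∞) (hf : nrm (c + θ) f < ∞) : nrm (c + θ) k < ∞ := by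
  obtain ⟨C, C0, Ct, hC⟩ := exists_lintegral_one_sub_exp (p := 1) (α := θ) hθ (by simpa using hθ1)
  have mk := h.right.meas
  have mf := h.left.meas
  set M := (1 + nrm c k) * (1 + nrm c k) with hM
  have Mt : M ≠ ∞ := by finiteness
  have diff {v : ℝ → ℝ} (hv : Lap v) {d : ℝ} (hd : 0 ≤ d) : nrm c (fun x ↦ v x - tilt d v x) =
      ∫⁻ x, (wt c x * ‖v x‖ₑ) * ENNReal.ofReal (1 - Real.exp (-(d * x))) ^ 1 := by
    refine lintegral_congr fun x ↦ ?_
    have := enorm_tilt_sub_tilt hv.supp 0 hd x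
    rw [zero_add, tilt_zero] at this
    rw [this, pow_one, mul_assoc]
  have key : ∫⁻ x, wt c x * ‖k x‖ₑ * ENNReal.ofReal (x ^ θ) ≤
      M * ∫⁻ x, wt c x * ‖f x‖ₑ * ENNReal.ofReal (x ^ θ) := by
    rw [← ENNReal.mul_le_mul_iff_right C0 Ct, mul_left_comm, ← hC _ (by fun_prop)
      (fun x hx ↦ by simp [h.right.supp x hx]), ← hC _ (by fun_prop)
      (fun x hx ↦ by simp [h.left.supp x hx]), ← lintegral_const_mul' _ _ Mt]
    refine setLIntegral_mono' measurableSet_Ioi fun d hd ↦ ?_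
    have hd : 0 < d := hd
    rw [mul_left_comm]
    gcongr
    rw [← diff h.right hd.le, ← diff h.left hd.le]
    have hD := h.left.sub (h.left.tilt hd.le)
    have hk' := h.right.tilt hd.le
    set D := fun x ↦ f x - tilt d f x with hDdef
    have e : nrm c (fun x ↦ k x - tilt d k x) = nrm c fun x ↦ (D x + conv k D x) +
        (conv D (tilt d k) x + conv k (conv D (tilt d k)) x) := by
      refine lintegral_congr_ae ?_
      filter_upwards [h.sub_tilt_ae_eq hd.le] with x hx
      rw [hx]
    have hkt : nrm c (tilt d k) ≤ nrm c k := nrm_tilt_le h.right.supp hd.le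
    calc nrm c (fun x ↦ k x - tilt d k x)
        ≤ (nrm c D + nrm c (conv k D)) + (nrm c (conv D (tilt d k)) +
          nrm c (conv k (conv D (tilt d k)))) := by
          rw [e]
          refine (nrm_add_le c (hD.add (h.right.conv hD)).meas).trans ?_
          gcongr
          · exact nrm_add_le c hD.meas
          · exact nrm_add_le c (hD.conv hk').meas
      _ ≤ (nrm c D + nrm c k * nrm c D) + (nrm c D * nrm c k + nrm c k * (nrm c D * nrm c k)) := by
          have h1 : nrm c (conv D (tilt d k)) ≤ nrm c D * nrm c k :=
            (nrm_conv_le hc hD.meas hk'.meas).trans (by gcongr)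
          gcongr
          · exact nrm_conv_le hc mk hD.meas
          · exact (nrm_conv_le hc mk (hD.conv hk').meas).trans (by gcongr)
      _ = _ := by rw [hM]; ring
  have h1 : nrm (c + θ) k ≤ ENNReal.ofReal (2 ^ θ) * (nrm c k + M * nrm (c + θ) f) := by
    calc nrm (c + θ) k ≤ ∫⁻ x, ENNReal.ofReal (2 ^ θ) *
          (wt c x * ‖k x‖ₑ + wt c x * ‖k x‖ₑ * ENNReal.ofReal (x ^ θ)) := by
          refine lintegral_mono fun x ↦ ?_
          rcases le_or_gt x 0 with hx | hx
          · simp [h.right.supp x hx]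
          · rw [← wt_mul]
            calc _ ≤ wt c x * (ENNReal.ofReal (2 ^ θ) * (1 + ENNReal.ofReal (x ^ θ))) * ‖k x‖ₑ := by
                  gcongr; exact wt_le_one_add hθ.le hx
              _ = _ := by ring
      _ = ENNReal.ofReal (2 ^ θ) * (nrm c k + ∫⁻ x, wt c x * ‖k x‖ₑ * ENNReal.ofReal (x ^ θ)) := by
          rw [lintegral_const_mul _ (by fun_prop), lintegral_add_left (by fun_prop), nrm]
      _ ≤ _ := by
          gcongr
          refine key.trans ?_
          gcongr
          refine lintegral_mono fun x ↦ ?_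
          rcases le_or_gt x 0 with hx | hx
          · simp [h.left.supp x hx]
          · rw [← wt_mul, mul_right_comm]
            gcongr
            exact ofReal_rpow_le_wt hθ.le hx
  refine h1.trans_lt ?_
  finiteness

lemma nrm_lt_top (h : IsResolvent f k) {a : ℝ} (ha : 0 ≤ a) (hk : nrm 0 k < ∞) (hf : nrm a f < ∞) :
    nrm a k < ∞ := by
  rcases ha.eq_or_lt with rfl | ha
  · exact hk
  -- The weight `a` is reached in `n > a` equal steps, each of size `a / n < 1`.
  obtain ⟨n, hn⟩ := exists_nat_gt a
  have hn0 : (0 : ℝ) < n := ha.trans hn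
  have : ∀ j : ℕ, j ≤ n → nrm (j * (a / n)) k < ∞ := by
    intro j
    induction j with
    | zero => intro _; simpa using hk
    | succ j ih =>
      intro hj
      have e : ((j + 1 : ℕ) : ℝ) * (a / n) = j * (a / n) + a / n := by push_cast; ring
      rw [e]
      refine h.nrm_lt_top_step (by positivity) (by positivity) ((div_lt_one hn0).2 hn)
        (ih (by omega)) ?_
      rw [← e]
      refine (nrm_mono ?_ f).trans_lt hf
      have : ((j + 1 : ℕ) : ℝ) ≤ n := by exact_mod_cast hj
      calc ((j + 1 : ℕ) : ℝ) * (a / n) ≤ n * (a / n) := by gcongr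
        _ = a := by field_simp
  have h2 := this n le_rfl
  rwa [mul_div_cancel₀ _ hn0.ne'] at h2

end IsResolvent
end Coarsening

/-! ### Convolution powers of densities and the renewal density. -/

namespace Coarsening
open scoped ENNReal FourierTransform

lemma conv_comm (a b : ℝ → ℝ) : conv a b = conv b a := by
  funext x
  rw [conv, conv, ← integral_sub_left_eq_self _ volume x]
  simp [mul_comm]

lemma sqn_neg (c : ℝ) (v : ℝ → ℝ) : sqn c (fun x ↦ -v x) = sqn c v := by simp [sqn]

lemma sqn_sub_lt_top {c : ℝ} {u v : ℝ → ℝ} (hu : Measurable u) (h1 : sqn c u < ∞)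
    (h2 : sqn c v < ∞) : sqn c (fun x ↦ u x - v x) < ∞ := by
  have := sqn_add_le c (v := fun x ↦ -v x) hu
  rw [sqn_neg] at this
  simp only [← sub_eq_add_neg] at this
  exact this.trans_lt (by finiteness)

lemma sqn_add_lt_top {c : ℝ} {u v : ℝ → ℝ} (hu : Measurable u) (h1 : sqn c u < ∞)
    (h2 : sqn c v < ∞) : sqn c (fun x ↦ u x + v x) < ∞ :=
  (sqn_add_le c hu).trans_lt (by finiteness)

lemma sqn_const_mul_lt_top {c : ℝ} {v : ℝ → ℝ} (r : ℝ) (hv : Measurable v) (h : sqn c v < ∞) :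
    sqn c (fun x ↦ r * v x) < ∞ := by
  have : sqn c (fun x ↦ r * v x) = ‖r‖ₑ ^ 2 * sqn c v := by
    rw [sqn, sqn, ← lintegral_const_mul _ (by fun_prop)]
    refine lintegral_congr fun x ↦ ?_
    rw [enorm_mul]; ring
  rw [this]
  finiteness

lemma sqn_congr_ae {c : ℝ} {u v : ℝ → ℝ} (h : u =ᵐ[volume] v) : sqn c u = sqn c v := by
  refine lintegral_congr_ae ?_
  filter_upwards [h] with x hx
  rw [hx]

/-- Probability densities on `(1,∞)`, extended by zero, in the weighted space `L²_γ`. -/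
structure Dens (γ : ℝ) (v : ℝ → ℝ) : Prop where
  meas : Measurable v
  nonneg : ∀ x, 0 ≤ v x
  supp : ∀ x ≤ 1, v x = 0
  int : Integrable v
  integral : ∫ x, v x = 1
  sqn : sqn γ v < ∞

namespace Dens

variable {γ : ℝ} {v : ℝ → ℝ}

lemma supp0 (h : Dens γ v) : ∀ x ≤ 0, v x = 0 := fun x hx ↦ h.supp x (hx.trans zero_le_one)

lemma lap (h : Dens γ v) : Lap v := Lap.of_integrable h.meas h.supp0 h.int

lemma integrable_cexp (h : Dens γ v) {z : ℂ} (hz : 0 ≤ z.re) :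
    Integrable fun x : ℝ ↦ Complex.exp (-(z * x)) * (v x : ℂ) :=
  integrable_cexp_mul_of_nonneg h.meas h.supp0 h.int hz

lemma conv (hγ : 0 ≤ γ) {w : ℝ → ℝ} (hv : Dens γ v) (hw : Dens γ w) : Dens γ (conv v w) where
  meas := measurable_conv hv.meas hw.meas
  nonneg x := integral_nonneg fun t ↦ mul_nonneg (hv.nonneg _) (hw.nonneg _)
  supp := conv_eq_zero hv.supp hw.supp0
  int := integrable_conv hv.int hw.int
  integral := by
    have := integral_convolution (μ := volume) (ν := volume) (ContinuousLinearMap.mul ℝ ℝ) hv.int hw.int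
    simpa [hv.integral, hw.integral, convolution_def] using! this
  sqn := sqn_conv_lt_top hγ hv.meas hw.meas (nrm_zero_lt_top hv.int) (nrm_zero_lt_top hw.int)
    hv.sqn hw.sqn

/-- The exponent starts at one: the zeroth convolution power would be a delta mass, and `Q` has no
constant term. -/
lemma exists_pow (hγ : 0 ≤ γ) (h : Dens γ v) (n : ℕ) : ∃ w, Dens γ w ∧ ∀ z : ℂ, 0 ≤ z.re →
    Coarsening.lap w z = Coarsening.lap v z ^ (n + 1) := by
  induction n with
  | zero => exact ⟨v, h, by simp⟩
  | succ n ih =>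
    obtain ⟨w, hw, hz⟩ := ih
    refine ⟨_, hw.conv hγ h, fun z h0 ↦ ?_⟩
    rw [lap_conv_of_integrable (hw.integrable_cexp h0) (h.integrable_cexp h0), hz z h0, ← pow_succ]

/-- The density is the mixture of the convolution powers of `v` with the coefficients of `Q` as
probabilities. -/
lemma exists_aeval (hγ : 0 ≤ γ) (h : Dens γ v) {Q : ℝ[X]} (hQ : IsMergingPolynomial Q) :
    ∃ w, Dens γ w ∧ ∀ z : ℂ, 0 ≤ z.re → Coarsening.lap w z = aeval (Coarsening.lap v z) Q := by
  choose P hP hPz using h.exists_pow hγ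
  have hsum : ∑ j ∈ Finset.range Q.natDegree, Q.coeff (j + 1) = 1 := by
    have := hQ.eval_one
    rw [eval_eq_sum_range, Finset.sum_range_succ'] at this
    simpa [hQ.coeff_zero] using this
  refine ⟨fun x ↦ ∑ j ∈ Finset.range Q.natDegree, Q.coeff (j + 1) * P j x, ⟨?_, ?_, ?_, ?_, ?_, ?_⟩, ?_⟩
  · exact Finset.measurable_fun_sum _ fun j _ ↦ (hP j).meas.const_mul _
  · exact fun x ↦ Finset.sum_nonneg fun j _ ↦ mul_nonneg (hQ.coeff_nonneg _) ((hP j).nonneg x)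
  · exact fun x hx ↦ Finset.sum_eq_zero fun j _ ↦ by simp [(hP j).supp x hx]
  · exact integrable_finsetSum _ fun j _ ↦ (hP j).int.const_mul _
  · rw [integral_finsetSum _ fun j _ ↦ (hP j).int.const_mul _]
    simpa [integral_const_mul, (hP _).integral] using hsum
  · have := Finset.sum_induction (s := Finset.range Q.natDegree)
      (fun j x ↦ Q.coeff (j + 1) * P j x) (fun v ↦ Measurable v ∧ Coarsening.sqn γ v < ∞)
      (fun a b ha hb ↦ ⟨ha.1.add hb.1, sqn_add_lt_top ha.1 ha.2 hb.2⟩) ⟨measurable_const, by simp [Coarsening.sqn]⟩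
      fun j _ ↦ ⟨(hP j).meas.const_mul _, sqn_const_mul_lt_top _ (hP j).meas (hP j).sqn⟩
    rw [Finset.sum_fn] at this
    exact this.2
  · intro z hz
    rw [aeval_eq_sum_range, Finset.sum_range_succ']
    simp only [hQ.coeff_zero, zero_smul, add_zero, Coarsening.lap]
    simp_rw [Complex.ofReal_sum, Finset.mul_sum]
    rw [integral_finsetSum]
    · refine Finset.sum_congr rfl fun j _ ↦ ?_
      have := lap_const_mul (P j) (Q.coeff (j + 1)) z
      rw [hPz j z hz] at this
      simpa [Coarsening.lap, Complex.real_smul] using this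
    · intro j _
      have := ((hP j).integrable_cexp hz).const_mul (Q.coeff (j + 1) : ℂ)
      simpa [mul_left_comm] using this

end Dens

section renewal

/-- The iterated convolutions `r, r ⋆ r, …`. -/
noncomputable def iterConv (r : ℝ → ℝ≥0∞) : ℕ → ℝ → ℝ≥0∞
  | 0 => r
  | n + 1 => r ⋆ₗ iterConv r n

lemma measurable_iterConv {r : ℝ → ℝ≥0∞} (hr : Measurable r) (n : ℕ) : Measurable (iterConv r n) := by
  induction n with
  | zero => exact hr
  | succ n ih => exact measurable_lconvolution _ hr ih

lemma iterConv_eq_zero {r : ℝ → ℝ≥0∞} (h : ∀ x ≤ 0, r x = 0) (n : ℕ) : ∀ x ≤ 0, iterConv r n x = 0 := by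
  induction n with
  | zero => exact h
  | succ n ih =>
    intro x hx
    rw [iterConv, lconvolution_def, ← lintegral_zero (α := ℝ) (μ := volume)]
    congr 1 with y
    rcases le_or_gt y 0 with hy | hy
    · simp [h y hy]
    · simp [ih (-y + x) (by linarith)]

lemma lintegral_exp_mul_lconvolution {A B : ℝ → ℝ≥0∞} (hA : Measurable A) (hB : Measurable B) (s : ℝ) :
    ∫⁻ x, ENNReal.ofReal (Real.exp (-(s * x))) * (A ⋆ₗ B) x =
      (∫⁻ x, ENNReal.ofReal (Real.exp (-(s * x))) * A x) *
        ∫⁻ x, ENNReal.ofReal (Real.exp (-(s * x))) * B x := by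
  rw [← lintegral_lconvolution (by fun_prop) (by fun_prop)]
  refine lintegral_congr fun x ↦ ?_
  rw [lconvolution_def, lconvolution_def, ← lintegral_const_mul _ (by fun_prop)]
  refine lintegral_congr fun y ↦ ?_
  have : Real.exp (-(s * x)) = Real.exp (-(s * y)) * Real.exp (-(s * (-y + x))) := by
    rw [← Real.exp_add]; ring_nf
  rw [this, ENNReal.ofReal_mul (by positivity)]
  ring

variable {γ : ℝ} {ρ : ℝ → ℝ}

/-- All the mass sits beyond `1`, so the integral is at most `e^{-s}`. It is the ratio of the
geometric series that sums the renewal density. -/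
lemma Dens.lintegral_exp_lt_one (h : Dens γ ρ) {s : ℝ} (hs : 0 < s) :
    ∫⁻ x, ENNReal.ofReal (Real.exp (-(s * x))) * ENNReal.ofReal (ρ x) < 1 := by
  calc _ ≤ ∫⁻ x, ENNReal.ofReal (Real.exp (-s)) * ENNReal.ofReal (ρ x) := by
        refine lintegral_mono fun x ↦ ?_
        rcases le_or_gt x 1 with hx | hx
        · simp [h.supp x hx]
        · gcongr; nlinarith
    _ = ENNReal.ofReal (Real.exp (-s)) := by
        rw [lintegral_const_mul' _ _ ENNReal.ofReal_ne_top, ← ofReal_integral_eq_lintegral_ofReal h.int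
          (Filter.Eventually.of_forall h.nonneg), h.integral]
        simp
    _ < 1 := by simpa [ENNReal.ofReal_lt_one] using hs

/-- The renewal density `U = ∑ ρ^{⋆k}`. -/
lemma Dens.exists_renewal (h : Dens γ ρ) (hγ : 0 ≤ γ) : ∃ U : ℝ → ℝ, Lap U ∧
    (∀ s, 0 < s → Coarsening.sqn 0 (tilt s U) < ∞) ∧
    ∀ z : ℂ, 0 < z.re → Coarsening.lap U z * (1 - Coarsening.lap ρ z) = Coarsening.lap ρ z := by
  set r : ℝ → ℝ≥0∞ := fun x ↦ ENNReal.ofReal (ρ x) with hr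
  have mr : Measurable r := h.meas.ennreal_ofReal
  have r0 : ∀ x ≤ 0, r x = 0 := fun x hx ↦ by simp [hr, h.supp0 x hx]
  set u : ℝ → ℝ≥0∞ := fun x ↦ ∑' n, iterConv r n x with hu
  have mi := measurable_iterConv mr
  have mu : Measurable u := Measurable.tsum mi
  have u0 : ∀ x ≤ 0, u x = 0 := fun x hx ↦ by simp [hu, iterConv_eq_zero r0 _ x hx]
  have ueq : ∀ x, u x = r x + (r ⋆ₗ u) x := by
    intro x
    simp only [hu]
    rw [tsum_eq_zero_add' ENNReal.summable, lconvolution_def]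
    congr 1
    simp_rw [← ENNReal.tsum_mul_left]
    rw [lintegral_tsum fun n ↦ by have := mi n; fun_prop]
    rfl
  have ufin : ∀ s, 0 < s → ∫⁻ x, ENNReal.ofReal (Real.exp (-(s * x))) * u x < ∞ := by
    intro s hs
    set q := ∫⁻ x, ENNReal.ofReal (Real.exp (-(s * x))) * r x with hq
    have hq1 : q < 1 := h.lintegral_exp_lt_one hs
    have hn : ∀ n, ∫⁻ x, ENNReal.ofReal (Real.exp (-(s * x))) * iterConv r n x = q ^ n * q := by
      intro n
      induction n with
      | zero => simp [iterConv, hq]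
      | succ n ih => rw [iterConv, lintegral_exp_mul_lconvolution mr (mi n), ih]; ring
    simp only [hu]
    simp_rw [← ENNReal.tsum_mul_left]
    rw [lintegral_tsum fun n ↦ by have := mi n; fun_prop]
    simp_rw [hn]
    rw [ENNReal.tsum_mul_right, ENNReal.tsum_geometric]
    have : (1 - q)⁻¹ ≠ ∞ := by simpa [tsub_eq_zero_iff_le] using hq1
    finiteness
  have uae : ∀ᵐ x, u x < ∞ := by
    filter_upwards [ae_lt_top (by fun_prop) (ufin 1 one_pos).ne] with x hx
    rcases ENNReal.mul_lt_top_iff.1 hx with h | h | h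
    · exact h.2
    · exact absurd h (by simp [Real.exp_pos])
    · simp [h]
  set U : ℝ → ℝ := fun x ↦ (u x).toReal with hU
  have LU : Lap U := by
    refine ⟨mu.ennreal_toReal, fun x hx ↦ by simp [hU, u0 x hx], fun s hs ↦ ⟨by fun_prop, ?_⟩⟩
    refine lt_of_le_of_lt (lintegral_mono fun x ↦ ?_) (ufin s hs)
    rw [enorm_mul, Real.enorm_of_nonneg (Real.exp_nonneg _), Real.enorm_of_nonneg ENNReal.toReal_nonneg]
    gcongr
    exact ENNReal.ofReal_toReal_le
  have Ueq : U =ᵐ[volume] fun x ↦ ρ x + Coarsening.conv ρ U x := by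
    filter_upwards [uae] with x hx
    have e := ueq x
    have hc : Coarsening.conv ρ U x = ((r ⋆ₗ u) x).toReal := by
      rw [lconvolution_def, ← integral_toReal (by fun_prop)]
      · refine integral_congr_ae (Filter.Eventually.of_forall fun t ↦ ?_)
        simp [hU, hr, ENNReal.toReal_ofReal (h.nonneg t), sub_eq_neg_add]
      · filter_upwards [(Measure.measurePreserving_sub_left volume x).quasiMeasurePreserving.ae uae] with t ht
        rw [sub_eq_neg_add] at ht
        exact ENNReal.mul_lt_top ENNReal.ofReal_lt_top ht
    have hfin : (r ⋆ₗ u) x ≠ ∞ := fun h ↦ by rw [e, h] at hx; simp at hx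
    rw [hc]
    change (u x).toReal = _
    rw [e, ENNReal.toReal_add ENNReal.ofReal_ne_top hfin, ENNReal.toReal_ofReal (h.nonneg x)]
  refine ⟨U, LU, fun s hs ↦ ?_, fun z hz ↦ ?_⟩
  -- Square integrability is read off the renewal equation: after tilting, `U` is in `L¹` and `ρ` in
  -- `L²`, so Young's inequality puts the convolution in `L²`.
  · have e : tilt s U =ᵐ[volume] fun x ↦ tilt s ρ x + Coarsening.conv (tilt s U) (tilt s ρ) x := by
      filter_upwards [Ueq] with x hx
      rw [← tilt_conv, conv_comm U ρ]
      simp only [tilt]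
      rw [hx]; ring
    have hsρ : Coarsening.sqn 0 (tilt s ρ) < ∞ :=
      (sqn_tilt_le h.supp0 hs.le).trans_lt ((sqn_mono hγ ρ).trans_lt h.sqn)
    have Lr := h.lap.tilt hs.le
    have LUs := LU.tilt hs.le
    rw [sqn_congr_ae e]
    refine sqn_add_lt_top Lr.meas hsρ ((sqn_conv_le LUs.meas Lr.meas LUs.supp Lr.supp).trans_lt ?_)
    have := nrm_zero_lt_top (LU.int s hs)
    rw [max_self]
    exact ENNReal.mul_lt_top (ENNReal.pow_lt_top this) hsρ
  · have : Coarsening.lap U z = Coarsening.lap ρ z + Coarsening.lap ρ z * Coarsening.lap U z := by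
      rw [← lap_conv h.lap LU hz, ← lap_add h.lap (h.lap.conv LU) hz]
      refine integral_congr_ae ?_
      filter_upwards [Ueq] with x hx
      rw [hx]
    linear_combination this

end renewal
end Coarsening

/-! ### Tail integrals, the lower bound for `1 - ρ̂`, and construction of the resolvent. -/

namespace Coarsening
open scoped ENNReal FourierTransform

/-- The indicator function of `(0,∞)`. -/
noncomputable def step (x : ℝ) : ℝ := if 0 < x then 1 else 0

lemma measurable_step : Measurable step :=
  Measurable.ite measurableSet_Ioi measurable_const measurable_const

lemma step_eq_indicator (g : ℝ → ℂ) :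
    (fun x ↦ g x * (step x : ℂ)) = (Ioi 0).indicator g := by
  funext x
  by_cases h : 0 < x <;> simp [step, indicator, h]

lemma lap_step_aux {z : ℂ} (hz : 0 < z.re) :
    IntegrableOn (fun x : ℝ ↦ Complex.exp (-(z * x))) (Ioi 0) ∧
      ∫ x in Ioi (0 : ℝ), Complex.exp (-(z * x)) = 1 / z := by
  have h1 := integrableOn_exp_mul_complex_Ioi (a := -z) (by simpa using hz) 0
  have h2 := integral_exp_mul_complex_Ioi (a := -z) (by simpa using hz) 0
  simp only [neg_mul] at h1 h2
  refine ⟨h1, h2.trans ?_⟩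
  simp [neg_div_neg_eq]

lemma Lap.step : Lap step := by
  refine ⟨measurable_step, fun x hx ↦ by simp [Coarsening.step, hx.not_gt], fun s hs ↦ ?_⟩
  have := (integrable_cexp_mul_iff measurable_step (s : ℂ)).1 (by
    rw [step_eq_indicator, integrable_indicator_iff measurableSet_Ioi]
    exact (lap_step_aux (z := s) (by simpa using hs)).1)
  simpa using this

lemma lap_step {z : ℂ} (hz : 0 < z.re) : lap Coarsening.step z = 1 / z := by
  rw [lap, step_eq_indicator, integral_indicator measurableSet_Ioi, (lap_step_aux hz).2]

section tail

/-- The tail integral `x ↦ ∫_x^∞ F` on `(0,∞)`, extended by zero. -/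
noncomputable def tail (F : ℝ → ℝ) (x : ℝ) : ℝ := (∫ t, F t) * Coarsening.step x - conv F Coarsening.step x

variable {F : ℝ → ℝ}

lemma Lap.tail (hF : Lap F) : Lap (tail F) := (Lap.step.const_mul _).sub (hF.conv Lap.step)

lemma lap_tail (hF : Lap F) {z : ℂ} (hz : 0 < z.re) :
    lap (Coarsening.tail F) z = ((∫ t, F t : ℝ) - lap F z) / z := by
  have := lap_sub (Lap.step.const_mul (∫ t, F t)) (hF.conv Lap.step) hz
  rw [lap_const_mul, lap_conv hF Lap.step hz, lap_step hz] at this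
  exact this.trans (by ring)

lemma tail_eq (hi : Integrable F) {x : ℝ} (hx : 0 < x) : Coarsening.tail F x = ∫ t in Ioi x, F t := by
  have h1 : conv F Coarsening.step x = ∫ t in Iio x, F t := by
    rw [← integral_indicator measurableSet_Iio]
    refine integral_congr_ae (Filter.Eventually.of_forall fun t ↦ ?_)
    by_cases h : t < x <;> simp [Coarsening.step, indicator, h]
  have h2 := integral_add_compl (measurableSet_Iio (a := x)) hi
  rw [compl_Iio, integral_Ici_eq_integral_Ioi] at h2
  rw [Coarsening.tail, h1, Coarsening.step, if_pos hx, ← h2]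
  ring

lemma sqn_tail_lt_top {a : ℝ} (ha : 1 / 2 < a) (hF : Lap F) (hi : Integrable F) (h : sqn a F < ∞) :
    sqn (a - 1) (Coarsening.tail F) < ∞ := by
  obtain ⟨C, hC, hH⟩ := hardy ha
  have mF := hF.meas
  have h1 : sqn (a - 1) (Coarsening.tail F) ≤
      ∫⁻ x in Ioi (0 : ℝ), (wt (a - 1) x * ∫⁻ t in Ioi x, ‖F t‖ₑ) ^ 2 := by
    rw [sqn, ← lintegral_indicator measurableSet_Ioi]
    refine lintegral_mono fun x ↦ ?_
    rcases le_or_gt x 0 with hx | hx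
    · simp [hF.tail.supp x hx]
    · simp only [mem_Ioi, hx, indicator_of_mem]
      gcongr
      rw [tail_eq hi hx]
      exact enorm_integral_le_lintegral_enorm _
  refine h1.trans_lt ((hH _ (by fun_prop)).trans_lt (ENNReal.mul_lt_top hC.lt_top ?_))
  exact (setLIntegral_le_lintegral _ _).trans_lt h

end tail

lemma continuousOn_lap {v : ℝ → ℝ} (hm : Measurable v) (hs : ∀ x ≤ 0, v x = 0) (hi : Integrable v) :
    ContinuousOn (lap v) {z | 0 ≤ z.re} := by
  refine continuousOn_of_dominated (bound := fun x ↦ ‖v x‖) (fun z _ ↦ by fun_prop)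
    (fun z hz ↦ Filter.Eventually.of_forall fun x ↦ ?_) hi.norm
    (Filter.Eventually.of_forall fun x ↦ by fun_prop)
  rw [norm_cexp_mul, norm_mul, Real.norm_eq_abs, Real.abs_exp]
  rcases le_or_gt x 0 with hx | hx
  · simp [hs x hx]
  · exact mul_le_of_le_one_left (norm_nonneg _) (by
      have : 0 ≤ z.re := hz
      rw [Real.exp_le_one_iff]; nlinarith)

lemma re_lap {v : ℝ → ℝ} {z : ℂ} (h : Integrable fun x : ℝ ↦ Complex.exp (-(z * x)) * (v x : ℂ)) :
    (lap v z).re = ∫ x, Real.exp (-(z.re * x)) * Real.cos (z.im * x) * v x := by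
  have := integral_re h
  rw [lap]
  refine this.symm.trans ?_
  congr 1 with x
  simp [Complex.exp_re]

namespace Dens

variable {γ : ℝ} {ρ : ℝ → ℝ}

lemma norm_lap_le (h : Dens γ ρ) {z : ℂ} (hz : 0 ≤ z.re) :
    ‖Coarsening.lap ρ z‖ ≤ Real.exp (-z.re) := by
  calc _ ≤ ∫ x, Real.exp (-z.re) * ρ x := by
        refine norm_integral_le_of_norm_le (h.int.const_mul _) (Filter.Eventually.of_forall fun x ↦ ?_)
        rw [norm_cexp_mul, norm_mul, Real.norm_eq_abs, Real.abs_exp, Real.norm_of_nonneg (h.nonneg x)]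
        rcases le_or_gt x 1 with hx | hx
        · simp [h.supp x hx]
        · gcongr
          · exact h.nonneg x
          · nlinarith
    _ = _ := by rw [integral_const_mul, h.integral, mul_one]

/-- Vanishing would confine `ρ` to the countable set where `cos (t x) = 1`, which is null. This
non-lattice property keeps `1 - ρ̂` from vanishing on the imaginary axis away from `0`. -/
lemma integral_one_sub_cos_pos (h : Dens γ ρ) {t : ℝ} (ht : t ≠ 0) :
    0 < ∫ x, (1 - Real.cos (t * x)) * ρ x := by
  have hnn : ∀ x, 0 ≤ (1 - Real.cos (t * x)) * ρ x := fun x ↦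
    mul_nonneg (by linarith [Real.cos_le_one (t * x)]) (h.nonneg x)
  have hi : Integrable fun x ↦ (1 - Real.cos (t * x)) * ρ x := by
    refine (h.int.const_mul 2).mono' (by have := h.meas; fun_prop) (Filter.Eventually.of_forall fun x ↦ ?_)
    rw [Real.norm_of_nonneg (hnn x)]
    gcongr
    · exact h.nonneg x
    · linarith [Real.neg_one_le_cos (t * x)]
  refine lt_of_le_of_ne (integral_nonneg hnn) fun h0 ↦ ?_
  have hae := (integral_eq_zero_iff_of_nonneg hnn hi).1 h0.symm
  have hc : {x : ℝ | Real.cos (t * x) = 1}.Countable := by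
    refine (countable_range fun n : ℤ ↦ (n : ℝ) * (2 * Real.pi) / t).mono fun x hx ↦ ?_
    obtain ⟨n, hn⟩ := (Real.cos_eq_one_iff _).1 hx
    exact ⟨n, by field_simp [hn]; linarith⟩
  have : ρ =ᵐ[volume] 0 := by
    filter_upwards [hae, hc.ae_notMem volume] with x h1 h2
    have h2 : Real.cos (t * x) ≠ 1 := h2
    have h1 : (1 - Real.cos (t * x)) * ρ x = 0 := h1
    exact (mul_eq_zero.1 h1).resolve_left fun h3 ↦ h2 (by linarith)
  have h1 := h.integral
  rw [integral_congr_ae this] at h1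
  simp at h1

lemma one_sub_re_fourier (h : Dens γ ρ) (t : ℝ) :
    1 - (𝓕 (fun x ↦ (ρ x : ℂ)) t).re = ∫ x, (1 - Real.cos (2 * Real.pi * t * x)) * ρ x := by
  have e := fourier_tilt ρ 0 t
  rw [tilt_zero] at e
  have hz : 0 ≤ (((0 : ℝ) : ℂ) + 2 * Real.pi * t * Complex.I).re := by simp
  rw [e, re_lap (h.integrable_cexp hz)]
  simp_rw [sub_mul, one_mul]
  rw [integral_sub h.int, h.integral]
  · simp
  · refine h.int.mono' (by have := h.meas; fun_prop) (Filter.Eventually.of_forall fun x ↦ ?_)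
    rw [norm_mul, Real.norm_of_nonneg (h.nonneg x)]
    exact mul_le_of_le_one_left (h.nonneg x) (Real.abs_cos_le_one _)

/-- The function of `t` is continuous, positive off `0`, and tends to `1` at infinity by
Riemann–Lebesgue; compactness handles the middle range. -/
lemma exists_le_integral_one_sub_cos (h : Dens γ ρ) {δ : ℝ} (hδ : 0 < δ) :
    ∃ c > 0, ∀ t, δ ≤ |t| → c ≤ ∫ x, (1 - Real.cos (t * x)) * ρ x := by
  set g : ℝ → ℝ := fun t ↦ 1 - (𝓕 (fun x ↦ (ρ x : ℂ)) t).re with hg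
  have hgpos : ∀ t, t ≠ 0 → 0 < g t := fun t ht ↦ by
    simp only [hg]
    rw [h.one_sub_re_fourier]
    exact h.integral_one_sub_cos_pos (by positivity)
  have hgc : Continuous g := by
    have : Continuous (𝓕 fun x ↦ (ρ x : ℂ)) :=
      VectorFourier.fourierIntegral_continuous Real.continuous_fourierChar
        (L := innerₗ ℝ) continuous_inner h.int.ofReal
    exact continuous_const.sub (Complex.continuous_re.comp this)
  have hlim : Filter.Tendsto g (Filter.cocompact ℝ) (nhds 1) := by
    have := (Complex.continuous_re.tendsto 0).comp (Real.zero_at_infty_fourier fun x ↦ (ρ x : ℂ))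
    simpa using this.const_sub 1
  obtain ⟨K, hK, hK'⟩ := Filter.mem_cocompact.1 (hlim.eventually (lt_mem_nhds (show (1 / 2 : ℝ) < 1 by norm_num)))
  set δ' := δ / (2 * Real.pi)
  have hδ' : 0 < δ' := by positivity
  have hKc : IsCompact (K ∩ {t | δ' ≤ |t|}) := hK.inter_right (isClosed_le continuous_const continuous_abs)
  have : ∃ c > 0, ∀ t, δ' ≤ |t| → c ≤ g t := by
    rcases (K ∩ {t | δ' ≤ |t|}).eq_empty_or_nonempty with he | hne
    · refine ⟨1 / 2, by norm_num, fun t ht ↦ (hK' (show t ∈ Kᶜ from fun hk ↦ ?_)).le⟩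
      have : t ∈ K ∩ {t | δ' ≤ |t|} := ⟨hk, ht⟩
      simp [he] at this
    · obtain ⟨t₀, ht₀, hmin⟩ := hKc.exists_isMinOn hne hgc.continuousOn
      have hp : 0 < g t₀ := hgpos t₀ (abs_pos.1 (hδ'.trans_le ht₀.2))
      refine ⟨min (1 / 2) (g t₀), by positivity, fun t ht ↦ ?_⟩
      by_cases hk : t ∈ K
      · exact (min_le_right _ _).trans (hmin ⟨hk, ht⟩)
      · exact (min_le_left _ _).trans (hK' hk).le
  obtain ⟨c, c0, hc⟩ := this
  refine ⟨c, c0, fun t ht ↦ ?_⟩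
  have h1 := hc (t / (2 * Real.pi)) (by
    rw [abs_div, abs_of_pos Real.two_pi_pos]; exact div_le_div_of_nonneg_right ht Real.two_pi_pos.le)
  simp only [hg] at h1
  rw [h.one_sub_re_fourier] at h1
  have e : 2 * Real.pi * (t / (2 * Real.pi)) = t := by field_simp
  rwa [e] at h1

lemma exists_le_norm_one_sub_lap (h : Dens γ ρ) {δ : ℝ} (hδ : 0 < δ) :
    ∃ c > 0, ∀ z : ℂ, 0 ≤ z.re → δ ≤ ‖z‖ → c ≤ ‖1 - Coarsening.lap ρ z‖ := by
  obtain ⟨c, c0, hc⟩ := h.exists_le_integral_one_sub_cos (half_pos hδ)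
  refine ⟨min (c / 2) (1 - Real.exp (-(δ / 2))), lt_min (by positivity) (by simpa using hδ),
    fun z hz hzδ ↦ ?_⟩
  -- If `Re z` is large, `|ρ̂| ≤ e^{-Re z}` suffices. Otherwise `|Im z| ≥ δ/2`, and `1 - r cos θ ≥
  -- (1 - cos θ)/2` for `0 ≤ r ≤ 1` reduces to the boundary estimate.
  rcases le_or_gt (δ / 2) z.re with h1 | h1
  · refine (min_le_right _ _).trans ?_
    have h2 := norm_sub_norm_le (1 : ℂ) (Coarsening.lap ρ z)
    have h3 := h.norm_lap_le hz
    have h4 : Real.exp (-z.re) ≤ Real.exp (-(δ / 2)) := by gcongr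
    rw [norm_one] at h2
    linarith
  · refine (min_le_left _ _).trans ?_
    have h2 : δ / 2 ≤ |z.im| := by
      have := Complex.norm_le_abs_re_add_abs_im z
      rw [abs_of_nonneg hz] at this
      linarith
    have hi := h.integrable_cexp hz
    have hre : (1 - Coarsening.lap ρ z).re =
        ∫ x, (1 - Real.exp (-(z.re * x)) * Real.cos (z.im * x)) * ρ x := by
      rw [Complex.sub_re, re_lap hi, Complex.one_re]
      nth_rewrite 1 [← h.integral]
      rw [← integral_sub h.int]
      · congr 1 with x; ring
      · refine hi.re.congr (Filter.Eventually.of_forall fun x ↦ ?_)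
        simp [Complex.exp_re]
    calc c / 2 ≤ (1 / 2) * ∫ x, (1 - Real.cos (z.im * x)) * ρ x := by linarith [hc _ h2]
      _ = ∫ x, (1 / 2) * ((1 - Real.cos (z.im * x)) * ρ x) := (integral_const_mul _ _).symm
      _ ≤ (1 - Coarsening.lap ρ z).re := by
        rw [hre]
        have mρ := h.meas
        have B : ∀ x, ρ x ≠ 0 → 0 < x := fun x hx ↦ by
          by_contra h0
          exact hx (h.supp0 x (not_lt.1 h0))
        refine integral_mono_of_nonneg (Filter.Eventually.of_forall fun x ↦ ?_) ?_
          (Filter.Eventually.of_forall fun x ↦ ?_)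
        · exact mul_nonneg (by norm_num) (mul_nonneg (by linarith [Real.cos_le_one (z.im * x)]) (h.nonneg x))
        · refine (h.int.const_mul 2).mono' (by fun_prop) (Filter.Eventually.of_forall fun x ↦ ?_)
          rw [norm_mul, Real.norm_of_nonneg (h.nonneg x)]
          by_cases hx : ρ x = 0
          · simp [hx]
          · gcongr
            · exact h.nonneg x
            have h5 : Real.exp (-(z.re * x)) ≤ 1 := by
              rw [Real.exp_le_one_iff]; nlinarith [B x hx]
            calc _ ≤ ‖(1 : ℝ)‖ + ‖Real.exp (-(z.re * x)) * Real.cos (z.im * x)‖ := norm_sub_le _ _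
              _ ≤ 1 + 1 * 1 := by
                rw [norm_one, norm_mul, Real.norm_eq_abs, Real.abs_exp]
                gcongr
                exact Real.abs_cos_le_one _
              _ = 2 := by norm_num
        · simp only
          by_cases hx : ρ x = 0
          · simp [hx]
          · rw [← mul_assoc]
            gcongr
            · exact h.nonneg x
            have h5 : Real.exp (-(z.re * x)) ≤ 1 := by
              rw [Real.exp_le_one_iff]; nlinarith [B x hx]
            have h6 := Real.exp_pos (-(z.re * x))
            rcases le_total 0 (Real.cos (z.im * x)) with h7 | h7
            · nlinarith [Real.cos_le_one (z.im * x)]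
            · nlinarith [Real.neg_one_le_cos (z.im * x)]
      _ ≤ _ := Complex.re_le_norm _

lemma lap_ne_one (h : Dens γ ρ) {z : ℂ} (hz : 0 < z.re) : 1 - Coarsening.lap ρ z ≠ 0 := by
  intro h0
  have h1 := h.norm_lap_le hz.le
  rw [← sub_eq_zero.1 h0, norm_one] at h1
  have : Real.exp (-z.re) < 1 := by simpa using hz
  linarith

lemma integrable_tail (h : Dens γ ρ) (hγ : 3 / 2 < γ) : Integrable (tail ρ) :=
  integrable_of_nrm h.lap.tail.meas (nrm_lt_top_of_sqn (b := γ - 1) (by linarith) h.lap.tail.meas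
    (sqn_tail_lt_top (by linarith) h.lap h.int h.sqn))

lemma tail_nonneg (h : Dens γ ρ) (x : ℝ) : 0 ≤ tail ρ x := by
  rcases le_or_gt x 0 with hx | hx
  · rw [h.lap.tail.supp x hx]
  · rw [tail_eq h.int hx]
    exact integral_nonneg h.nonneg

/-- The tail equals `1` on `(0, 1]`, since `ρ` has no mass there. -/
lemma one_le_integral_tail (h : Dens γ ρ) (hγ : 3 / 2 < γ) : 1 ≤ ∫ x, tail ρ x := by
  calc (1 : ℝ) = ∫ x in Ioc (0 : ℝ) 1, (1 : ℝ) := by simp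
    _ = ∫ x in Ioc (0 : ℝ) 1, tail ρ x := by
      refine setIntegral_congr_fun measurableSet_Ioc fun x hx ↦ ?_
      rw [tail_eq h.int hx.1, ← h.integral]
      refine (setIntegral_eq_integral_of_forall_compl_eq_zero fun t ht ↦ h.supp t ?_).symm
      exact (not_lt.1 ht).trans hx.2
    _ ≤ _ := setIntegral_le_integral (h.integrable_tail hγ) (Filter.Eventually.of_forall h.tail_nonneg)

lemma lap_tail (h : Dens γ ρ) {z : ℂ} (hz : 0 < z.re) :
    Coarsening.lap (tail ρ) z = (1 - Coarsening.lap ρ z) / z := by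
  rw [Coarsening.lap_tail h.lap hz, h.integral, Complex.ofReal_one]

/-- The kernel `ρ - ∫_·^∞ ρ` has an integrable resolvent. -/
lemma exists_isResolvent (h : Dens γ ρ) (hγ : 3 / 2 < γ) :
    ∃ k, IsResolvent (fun x ↦ ρ x - tail ρ x) k := by
  obtain ⟨U, LU, hU2, hU⟩ := h.exists_renewal (by linarith)
  have Le : Lap (tilt 1 Coarsening.step) := Lap.step.tilt zero_le_one
  have LC := Le.conv LU
  have hz0 {z : ℂ} (hz : 0 < z.re) : z ≠ 0 := fun h ↦ by simp [h] at hz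
  have hlf {z : ℂ} (hz : 0 < z.re) : Coarsening.lap (fun x ↦ ρ x - tail ρ x) z =
      Coarsening.lap ρ z - (1 - Coarsening.lap ρ z) / z := by
    rw [lap_sub h.lap h.lap.tail hz, h.lap_tail hz]
  have h1f {z : ℂ} (hz : 0 < z.re) : 1 - Coarsening.lap (fun x ↦ ρ x - tail ρ x) z =
      (1 - Coarsening.lap ρ z) * ((1 + z) / z) := by
    rw [hlf hz]
    field_simp [hz0 hz]
    ring
  have hn {z : ℂ} (hz : 0 < z.re) : ‖z‖ ≤ ‖1 + z‖ := by
    rw [Complex.norm_def, Complex.norm_def]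
    refine Real.sqrt_le_sqrt ?_
    simp only [Complex.normSq_apply, Complex.add_re, Complex.add_im, Complex.one_re, Complex.one_im]
    nlinarith
  have hn1 {z : ℂ} (hz : 0 < z.re) : 1 ≤ ‖1 + z‖ := by
    have := Complex.abs_re_le_norm (1 + z)
    rw [Complex.add_re, Complex.one_re, abs_of_pos (by linarith)] at this
    linarith
  -- With `e` the exponential density, `1 + k̂ = (1 + Û)(1 - ê) = z / ((1 - ρ̂)(1 + z))`: the zero
  -- of `1 - ê` at `0` cancels the pole of `1 + Û`.
  refine ⟨fun x ↦ (U x - tilt 1 Coarsening.step x) - Coarsening.conv (tilt 1 Coarsening.step) U x,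
    h.lap.sub h.lap.tail, (LU.sub Le).sub LC, fun s hs ↦ ?_, ?_, fun z hz ↦ ?_⟩
  · have e : tilt s (fun x ↦ (U x - tilt 1 Coarsening.step x) - Coarsening.conv (tilt 1 Coarsening.step) U x) =
        fun x ↦ (tilt s U x - tilt s (tilt 1 Coarsening.step) x) -
          Coarsening.conv (tilt s U) (tilt s (tilt 1 Coarsening.step)) x := by
      funext x
      rw [← tilt_conv, conv_comm U]
      simp only [tilt]
      ring
    have he : Coarsening.sqn 0 (tilt s (tilt 1 Coarsening.step)) < ∞ := by
      refine (sqn_tilt_le Le.supp hs.le).trans_lt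
        (lt_of_le_of_lt ?_ (nrm_zero_lt_top (Lap.step.int 1 one_pos)))
      refine lintegral_mono fun x ↦ ?_
      have h1 : ‖tilt 1 Coarsening.step x‖ₑ ≤ 1 :=
        (enorm_tilt_le Lap.step.supp zero_le_one x).trans (by
          unfold Coarsening.step; split_ifs <;> simp)
      -- Since the exponential density is at most `1`, its square is at most itself.
      rw [wt_zero, one_mul, one_mul, pow_two]
      exact mul_le_of_le_one_left' h1
    have LUs := LU.tilt hs.le
    have Les := Le.tilt hs.le
    rw [e]
    refine sqn_sub_lt_top (LUs.sub Les).meas (sqn_sub_lt_top LUs.meas (hU2 s hs) he)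
      ((sqn_conv_le LUs.meas Les.meas LUs.supp Les.supp).trans_lt ?_)
    rw [max_self]
    exact ENNReal.mul_lt_top (ENNReal.pow_lt_top (nrm_zero_lt_top (LU.int s hs))) he
  · have hm := h.one_le_integral_tail hγ
    have hcont := continuousOn_lap h.lap.tail.meas h.lap.tail.supp (h.integrable_tail hγ)
    have hlap0 : Coarsening.lap (tail ρ) 0 = (∫ x, tail ρ x : ℝ) := by
      rw [Coarsening.lap, ← integral_complex_ofReal]; simp
    obtain ⟨δ, δ0, hδ⟩ := Metric.continuousOn_iff.1 hcont 0 (by simp) (1 / 2) (by norm_num)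
    obtain ⟨c, c0, hc⟩ := h.exists_le_norm_one_sub_lap δ0
    refine ⟨min c (1 / 2), by positivity, fun z hz ↦ ?_⟩
    rw [h1f hz]
    -- Near `0` write `1 - f̂ = T̂(z)(1 + z)` with `T̂(0) = ∫ T ≥ 1`; away from `0` use the lower
    -- bound for `1 - ρ̂` and `|(1 + z)/z| ≥ 1`.
    rcases lt_or_ge ‖z‖ δ with h1 | h1
    · refine (min_le_right _ _).trans ?_
      have h2 := hδ z hz.le (by simpa using h1)
      rw [hlap0, dist_comm, dist_eq_norm] at h2
      have h3 := norm_sub_norm_le ((∫ x, tail ρ x : ℝ) : ℂ) (Coarsening.lap (tail ρ) z)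
      rw [Complex.norm_real, Real.norm_of_nonneg (by linarith)] at h3
      have e : (1 - Coarsening.lap ρ z) * ((1 + z) / z) = Coarsening.lap (tail ρ) z * (1 + z) := by
        rw [h.lap_tail hz]; ring
      rw [e, norm_mul]
      nlinarith [hn1 hz, norm_nonneg (Coarsening.lap (tail ρ) z)]
    · refine (min_le_left _ _).trans ((hc z hz.le h1).trans ?_)
      rw [norm_mul]
      refine le_mul_of_one_le_right (norm_nonneg _) ?_
      rw [norm_div, one_le_div (norm_pos_iff.2 (hz0 hz))]
      exact hn hz
  · have hz1 : (1 : ℂ) + z ≠ 0 := fun h0 ↦ by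
      have := hn1 hz
      rw [h0, norm_zero] at this
      linarith
    have hz1' : 0 < (z + (1 : ℝ)).re := by simp; linarith
    have hk : Coarsening.lap (fun x ↦ (U x - tilt 1 Coarsening.step x) - Coarsening.conv (tilt 1 Coarsening.step) U x) z =
        Coarsening.lap U z - 1 / (1 + z) - 1 / (1 + z) * Coarsening.lap U z := by
      rw [lap_sub (LU.sub Le) LC hz, lap_sub LU Le hz, lap_conv Le LU hz, lap_tilt, lap_step hz1',
        Complex.ofReal_one, add_comm z 1]
    have hUz := hU z hz
    have h10 := h.lap_ne_one hz
    have hUz' : Coarsening.lap U z = Coarsening.lap ρ z / (1 - Coarsening.lap ρ z) := by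
      rw [eq_div_iff h10, hUz]
    rw [hk, h1f hz, hlf hz, hUz']
    field_simp [hz0 hz]
    ring

end Dens
end Coarsening

/-! ### Behaviour at `z = 0` and the remainder after removing the pole. -/

namespace Coarsening
open scoped ENNReal Topology

lemma exists_one_sub_eq_mul {Q : ℝ[X]} (hQ : IsMergingPolynomial Q) :
    ∃ S : ℝ[X], 1 - Q = (1 - X) * S ∧ S.eval 1 = q Q := by
  have h : (1 - Q).IsRoot 1 := by simp [hQ.eval_one]
  obtain ⟨T, hT⟩ := dvd_iff_isRoot.2 h
  rw [C_1] at hT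
  refine ⟨-T, by rw [hT]; ring, ?_⟩
  have := congrArg (fun P ↦ (derivative P).eval 1) hT
  simp at this
  rw [q, eval_neg, ← this, neg_neg]

lemma IsMergingPolynomial.one_le_q {Q : ℝ[X]} (hQ : IsMergingPolynomial Q) : 1 ≤ q Q := by
  have h := hQ.eval_one
  rw [eval_eq_sum_range] at h
  rw [q, derivative_eval, sum_over_range _ (by simp)]
  refine h.symm.le.trans (Finset.sum_le_sum fun j _ ↦ ?_)
  rcases Nat.eq_zero_or_pos j with rfl | hj
  · simp [hQ.coeff_zero]
  · simp only [one_pow, mul_one]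
    exact le_mul_of_one_le_right (hQ.coeff_nonneg j) (Nat.one_le_cast.2 hj)

lemma lap_ofReal (v : ℝ → ℝ) (s : ℝ) : lap v s = (∫ x, tilt s v x : ℝ) := by
  rw [lap, ← integral_complex_ofReal]
  simp [tilt]

lemma tendsto_integral_tilt {v : ℝ → ℝ} (hm : Measurable v) (hs : ∀ x ≤ 0, v x = 0)
    (hi : Integrable v) :
    Filter.Tendsto (fun s ↦ ∫ x, tilt s v x) (𝓝[>] 0) (𝓝 (∫ x, v x)) := by
  refine tendsto_integral_filter_of_dominated_convergence (fun x ↦ ‖v x‖) ?_ ?_ hi.norm ?_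
  · exact Filter.Eventually.of_forall fun s ↦ by unfold tilt; fun_prop
  · filter_upwards [self_mem_nhdsWithin] with s hs'
    refine Filter.Eventually.of_forall fun x ↦ ?_
    have := enorm_tilt_le hs (le_of_lt hs') x
    rwa [enorm_le_iff_norm_le] at this
  · refine Filter.Eventually.of_forall fun x ↦ ?_
    have h2 : Continuous fun s ↦ tilt s v x := by unfold tilt; fun_prop
    have := h2.tendsto 0
    rw [tilt_zero] at this
    exact this.mono_left nhdsWithin_le_nhds

namespace Dens

variable {γ : ℝ} {η : ℝ → ℝ}

lemma lap_id_mul (h : Dens γ η) (hγ : 3 / 2 < γ) : Integrable (fun x ↦ x * η x) ∧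
    Coarsening.sqn (γ - 1) (fun x ↦ x * η x) < ∞ ∧ Lap fun x ↦ x * η x := by
  have mη := h.meas
  have h1 : Coarsening.sqn (γ - 1) (fun x ↦ x * η x) < ∞ := by
    refine lt_of_le_of_lt (lintegral_mono fun x ↦ ?_) h.sqn
    have : ‖x‖ₑ ≤ wt 1 x := by
      rw [wt, Real.rpow_one, Real.enorm_eq_ofReal_abs]
      exact ENNReal.ofReal_le_ofReal (by linarith)
    have e : wt γ x = wt (γ - 1) x * wt 1 x := by rw [wt_mul, sub_add_cancel]
    rw [enorm_mul, ← mul_assoc, e]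
    gcongr
  have h2 : Integrable fun x ↦ x * η x :=
    integrable_of_nrm (by fun_prop) (nrm_lt_top_of_sqn (b := γ - 1) (by linarith) (by fun_prop) h1)
  exact ⟨h2, h1, Lap.of_integrable (by fun_prop) (fun x hx ↦ by simp [h.supp0 x hx]) h2⟩

lemma one_le_integral_id_mul (h : Dens γ η) (hγ : 3 / 2 < γ) : 1 ≤ ∫ x, x * η x := by
  rw [← h.integral]
  refine integral_mono h.int (h.lap_id_mul hγ).1 fun x ↦ ?_
  rcases le_or_gt x 1 with hx | hx
  · simp [h.supp x hx]
  · exact le_mul_of_one_le_left (h.nonneg x) hx.le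

/-- Dominated convergence with majorant `x η(x)`, from `(1 - e^{-sx})/s ≤ x`. -/
lemma tendsto_one_sub_div (h : Dens γ η) (hγ : 3 / 2 < γ) :
    Filter.Tendsto (fun s ↦ (1 - ∫ x, tilt s η x) / s) (𝓝[>] 0) (𝓝 (∫ x, x * η x)) := by
  have e : (fun s ↦ ∫ x, ((1 - Real.exp (-(s * x))) / s) * η x) =ᶠ[𝓝[>] 0]
      fun s ↦ (1 - ∫ x, tilt s η x) / s := by
    filter_upwards [self_mem_nhdsWithin] with s hs
    have hs : 0 < s := hs
    have h1 : ∫ x, (1 - Real.exp (-(s * x))) / s * η x = ∫ x, s⁻¹ * (η x - tilt s η x) := by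
      congr 1 with x
      simp only [tilt]; ring
    have hti : Integrable (tilt s η) := h.lap.int s hs
    rw [h1, integral_const_mul, integral_sub h.int hti, h.integral]
    ring
  refine Filter.Tendsto.congr' e ?_
  have mη := h.meas
  refine tendsto_integral_filter_of_dominated_convergence (fun x ↦ x * η x) ?_ ?_
    (h.lap_id_mul hγ).1 ?_
  · exact Filter.Eventually.of_forall fun s ↦ by fun_prop
  · filter_upwards [self_mem_nhdsWithin] with s hs
    have hs : 0 < s := hs
    refine Filter.Eventually.of_forall fun x ↦ ?_
    rcases le_or_gt x 0 with hx | hx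
    · simp [h.supp0 x hx]
    · have h2 : 0 ≤ 1 - Real.exp (-(s * x)) := by
        simpa using (mul_pos hs hx).le
      rw [norm_mul, Real.norm_of_nonneg (h.nonneg x), Real.norm_of_nonneg (by positivity)]
      gcongr
      · exact h.nonneg x
      · rw [div_le_iff₀ hs]
        linarith [Real.add_one_le_exp (-(s * x))]
  · refine Filter.Eventually.of_forall fun x ↦ ?_
    have h3 : HasDerivAt (fun s ↦ 1 - Real.exp (-(s * x))) x 0 := by
      have := (((hasDerivAt_id (0 : ℝ)).mul_const x).neg.exp).const_sub 1
      simpa using this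
    have := h3.tendsto_slope_zero_right
    simp only [zero_add, zero_mul, neg_zero, Real.exp_zero, sub_self, sub_zero, smul_eq_mul] at this
    refine (this.congr fun s ↦ ?_).mul_const (η x)
    rw [inv_mul_eq_div]

end Dens

lemma Lap.shift {v : ℝ → ℝ} (hv : Lap v) (r : ℝ) (hr : 0 ≤ r) : Lap fun x ↦ v (x - r) := by
  have mv := hv.meas
  refine ⟨by fun_prop, fun x hx ↦ hv.supp _ (by linarith), fun s hs ↦ ?_⟩
  have := ((hv.int s hs).comp_sub_right r).const_mul (Real.exp (-(s * r)))
  refine this.congr (Filter.Eventually.of_forall fun x ↦ ?_)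
  simp only
  rw [← mul_assoc, ← Real.exp_add]
  ring_nf

lemma lap_shift (v : ℝ → ℝ) (r : ℝ) (z : ℂ) :
    lap (fun x ↦ v (x - r)) z = Complex.exp (-(z * r)) * lap v z := by
  rw [lap, lap, ← integral_const_mul, ← integral_sub_right_eq_self
    (fun x : ℝ ↦ Complex.exp (-(z * r)) * (Complex.exp (-(z * x)) * (v x : ℂ))) r]
  congr 1 with x
  rw [← mul_assoc, ← Complex.exp_add]
  push_cast
  ring_nf

lemma sqn_shift_lt_top {c : ℝ} (hc : 0 ≤ c) {v : ℝ → ℝ} (hv : Measurable v) (h : sqn c v < ∞) (r : ℝ) :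
    sqn c (fun x ↦ v (x - r)) < ∞ := by
  have : sqn c (fun x ↦ v (x - r)) ≤ wt c r ^ 2 * sqn c v := by
    rw [sqn, sqn, ← lintegral_sub_right_eq_self (μ := volume) (fun x ↦ (wt c x * ‖v x‖ₑ) ^ 2) r,
      ← lintegral_const_mul _ (by fun_prop)]
    refine lintegral_mono fun x ↦ ?_
    rw [← mul_pow, ← mul_assoc]
    gcongr
    have := wt_add_le hc r (x - r)
    rwa [add_sub_cancel] at this
  exact this.trans_lt (ENNReal.mul_lt_top (ENNReal.pow_lt_top (wt_ne_top c r).lt_top) h)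

/-- The remainder `y 𝒩(η)(y) - (1/q) 1_{y > 1}` together with its Laplace transform. -/
lemma Dens.exists_remainder {γ : ℝ} {η : ℝ → ℝ} (h : Dens γ η) (hγ : 3 / 2 < γ) {Q : ℝ[X]}
    (hQ : IsMergingPolynomial Q) :
    ∃ E : ℝ → ℝ, Lap E ∧ (∀ x ≤ 1, E x = 0) ∧ Coarsening.sqn (γ - 2) E < ∞ ∧
      ∀ z : ℂ, 0 < z.re → Coarsening.lap E z + (1 / q Q : ℝ) * (Complex.exp (-z) / z) =
        Coarsening.lap (fun x ↦ x * η x) z / (1 - aeval (Coarsening.lap η z) Q) := by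
  obtain ⟨ρ, hρ, hρη⟩ := h.exists_aeval (by linarith) hQ
  obtain ⟨k, hk⟩ := hρ.exists_isResolvent hγ
  obtain ⟨gi, gs, gL⟩ := h.lap_id_mul hγ
  have hq : 0 < q Q := by linarith [hQ.one_le_q]
  have tL := hρ.lap.tail
  have ti := hρ.integrable_tail hγ
  have ts := sqn_tail_lt_top (by linarith) hρ.lap hρ.int hρ.sqn
  -- For `γ < 2` the target weight `γ - 2` is negative and plain integrability of `k` is enough. In
  -- all cases `a + 1/2 < γ - 1`, so the `L²` decay of the kernel `ρ - T` gives the required `L¹`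
  -- weight.
  set a := max (γ - 2) 0 with ha
  have hka : nrm a k < ∞ := by
    have hf := sqn_sub_lt_top hρ.meas ((sqn_mono (by linarith : γ - 1 ≤ γ) ρ).trans_lt hρ.sqn) ts
    have ha' : a + 1 / 2 < γ - 1 := by
      have : a < γ - 3 / 2 := max_lt (by linarith) (by linarith)
      linarith
    exact hk.nrm_lt_top (le_max_right _ _) (hk.nrm_zero_lt_top (by linarith) hf)
      (nrm_lt_top_of_sqn ha' hk.left.meas hf)
  -- Compare limits as `s → 0+`: factoring `1 - Q = (1 - X) S`, the tail transform is `S(η̂(s)) (1 -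
  -- η̂(s))/s`, and `S(1) = q`.
  have hmean : ∫ x, tail ρ x = q Q * ∫ x, x * η x := by
    obtain ⟨S, hS, hS1⟩ := exists_one_sub_eq_mul hQ
    have h1 := tendsto_integral_tilt tL.meas tL.supp ti
    have h2 := tendsto_integral_tilt h.meas h.supp0 h.int
    rw [h.integral] at h2
    have h3 := ((S.continuous.tendsto 1).comp h2).mul (h.tendsto_one_sub_div hγ)
    rw [hS1] at h3
    refine tendsto_nhds_unique (h1.congr' ?_) h3
    filter_upwards [self_mem_nhdsWithin] with s hs
    have hs' : 0 < (s : ℂ).re := by simpa using hs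
    have h4 := hρ.lap_tail hs'
    rw [hρη s hs'.le, lap_ofReal, lap_ofReal] at h4
    have h5 := congrArg (eval (∫ x, tilt s η x)) hS
    simp only [eval_sub, eval_one, eval_mul, eval_X] at h5
    have h6 : aeval ((∫ x, tilt s η x : ℝ) : ℂ) Q = (Q.eval (∫ x, tilt s η x) : ℝ) :=
      aeval_algebraMap_apply_eq_algebraMap_eval _ _
    rw [h6] at h4
    have h7 : ∫ x, tilt s (tail ρ) x = (1 - Q.eval (∫ x, tilt s η x)) / s := by exact_mod_cast h4
    rw [h7, h5, Function.comp_apply]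
    ring
  have sL := (Lap.shift tL 1 zero_le_one).const_mul (1 / q Q)
  have ss := sqn_const_mul_lt_top (1 / q Q) (by have := tL.meas; fun_prop)
    (sqn_shift_lt_top (by linarith) tL.meas ts 1)
  -- Multiplying `e^{-z}/z` by `1 - ρ̂ = z T̂` gives `e^{-z} T̂`, hence the shifted tail. The factor
  -- `1/q` makes the integral vanish.
  set G : ℝ → ℝ := fun x ↦ x * η x - 1 / q Q * tail ρ (x - 1) with hG
  have LG : Lap G := gL.sub sL
  have Gs : Coarsening.sqn (γ - 1) G < ∞ := sqn_sub_lt_top gL.meas gs ss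
  have Gi : Integrable G := integrable_of_nrm LG.meas
    (nrm_lt_top_of_sqn (b := γ - 1) (by linarith) LG.meas Gs)
  have G0 : ∫ x, G x = 0 := by
    simp only [hG]
    rw [integral_sub gi ((ti.comp_sub_right 1).const_mul _), integral_const_mul,
      integral_sub_right_eq_self (tail ρ), hmean]
    field_simp
    ring
  have G1 : ∀ x ≤ 1, G x = 0 := fun x hx ↦ by
    simp [hG, h.supp x hx, tL.supp (x - 1) (by linarith)]
  -- As `∫ G = 0`, the tail has transform `-Ĝ/z`, so `K̂ = (1 + 1/z) Ĝ`. The zero mean also makes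
  -- the tail vanish up to `1`.
  set K := fun x ↦ G x - tail G x with hK
  have KL : Lap K := LG.sub LG.tail
  have Ks : Coarsening.sqn (γ - 2) K < ∞ := by
    refine sqn_sub_lt_top LG.meas ((sqn_mono (by linarith) G).trans_lt Gs) ?_
    have := sqn_tail_lt_top (a := γ - 1) (by linarith) LG Gi Gs
    rwa [show γ - 1 - 1 = γ - 2 by ring] at this
  have K1 : ∀ x ≤ 1, K x = 0 := fun x hx ↦ by
    have : tail G x = 0 := by
      rcases le_or_gt x 0 with hx0 | hx0
      · exact LG.tail.supp x hx0
      · rw [tail_eq Gi hx0, ← G0]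
        exact setIntegral_eq_integral_of_forall_compl_eq_zero fun t ht ↦ G1 t ((not_lt.1 ht).trans hx)
    simp [hK, G1 x hx, this]
  refine ⟨fun x ↦ K x + Coarsening.conv k K x, KL.add (hk.right.conv KL), fun x hx ↦ ?_, ?_, fun z hz ↦ ?_⟩
  · simp only
    rw [K1 x hx, conv_comm, conv_eq_zero K1 hk.right.supp x hx, add_zero]
  · refine sqn_add_lt_top KL.meas Ks ((sqn_conv_le hk.right.meas KL.meas hk.right.supp KL.supp).trans_lt ?_)
    exact ENNReal.mul_lt_top (ENNReal.pow_lt_top hka) Ks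
  · have hz0 : z ≠ 0 := fun h0 ↦ by simp [h0] at hz
    have h1 := hρ.lap_ne_one hz
    have hf := hk.eq z hz
    rw [lap_sub hρ.lap tL hz, hρ.lap_tail hz] at hf
    have hGz : Coarsening.lap G z = Coarsening.lap (fun x ↦ x * η x) z -
        (1 / q Q : ℝ) * (Complex.exp (-z) * ((1 - Coarsening.lap ρ z) / z)) := by
      rw [lap_sub gL sL hz, lap_const_mul, lap_shift, hρ.lap_tail hz]
      simp
    rw [lap_add KL (hk.right.conv KL) hz, lap_conv hk.right KL hz, lap_sub LG LG.tail hz,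
      Coarsening.lap_tail LG hz, G0, ← hρη z hz.le, eq_div_iff h1]
    have hf2 : (1 + Coarsening.lap k z) * ((1 - Coarsening.lap ρ z) * (1 + z)) = z := by
      field_simp at hf
      linear_combination hf
    have e : (Coarsening.lap G z - (((0 : ℝ) : ℂ) - Coarsening.lap G z) / z +
        Coarsening.lap k z * (Coarsening.lap G z - (((0 : ℝ) : ℂ) - Coarsening.lap G z) / z)) *
        (1 - Coarsening.lap ρ z) = Coarsening.lap G z := by
      field_simp
      push_cast
      linear_combination Coarsening.lap G z * hf2
    rw [add_mul, e, hGz]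
    ring

end Coarsening

/-! ### The function `φ`, recovery of `φ(η̂)` from its derivative, and uniqueness. -/

namespace Coarsening
open scoped ENNReal Topology FourierTransform

section phi

variable {Q : ℝ[X]}

lemma IsMergingPolynomial.norm_aeval_le (hQ : IsMergingPolynomial Q) {z : ℂ} (hz : ‖z‖ ≤ 1) :
    ‖aeval z Q‖ ≤ ‖z‖ := by
  have h := hQ.eval_one
  rw [eval_eq_sum_range] at h
  rw [aeval_eq_sum_range]
  calc _ ≤ ∑ j ∈ Finset.range (Q.natDegree + 1), Q.coeff j * 1 ^ j * ‖z‖ := by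
        refine norm_sum_le_of_le _ fun j _ ↦ ?_
        rw [norm_smul, norm_pow, Real.norm_of_nonneg (hQ.coeff_nonneg j), one_pow, mul_one]
        rcases Nat.eq_zero_or_pos j with rfl | hj
        · simp [hQ.coeff_zero]
        · exact mul_le_mul_of_nonneg_left (pow_le_of_le_one (norm_nonneg _) hz hj.ne') (hQ.coeff_nonneg j)
    _ = ‖z‖ := by rw [← Finset.sum_mul, h, one_mul]

lemma IsMergingPolynomial.one_sub_aeval_ne_zero (hQ : IsMergingPolynomial Q) {z : ℂ} (hz : ‖z‖ < 1) :
    1 - aeval z Q ≠ 0 := fun h ↦ by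
  have := hQ.norm_aeval_le hz.le
  rw [← sub_eq_zero.1 h, norm_one] at this
  linarith

lemma phi_zero : phi Q 0 = 0 := by simp [phi]

/-- A holomorphic function on the disc has a primitive; along each radius the fundamental theorem of
calculus identifies it with the segment integral. -/
lemma hasDerivAt_phi (hQ : IsMergingPolynomial Q) {z : ℂ} (hz : ‖z‖ < 1) :
    HasDerivAt (phi Q) (1 / (1 - aeval z Q)) z := by
  have hdiff : DifferentiableOn ℂ (fun z : ℂ ↦ 1 / (1 - aeval z Q)) (Metric.ball 0 1) := fun w hw ↦ by
    have hw : 1 - aeval w Q ≠ 0 := hQ.one_sub_aeval_ne_zero (by simpa using hw)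
    have hd : DifferentiableAt ℂ (fun z : ℂ ↦ 1 - aeval z Q) w :=
      (differentiableAt_const _).sub (Polynomial.differentiableAt_aeval Q)
    exact ((differentiableAt_const _).div hd hw).differentiableWithinAt
  obtain ⟨g, g0, hg⟩ := hdiff.isExactOn_ball.with_val_at 0 0
  have key : ∀ w ∈ Metric.ball (0 : ℂ) 1, phi Q w = g w := by
    intro w hw
    have hw1 : ‖w‖ < 1 := by simpa using hw
    have hmem : ∀ t ∈ uIcc (0 : ℝ) 1, (t : ℂ) * w ∈ Metric.ball (0 : ℂ) 1 := fun t ht ↦ by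
      rw [uIcc_of_le zero_le_one] at ht
      rw [mem_ball_zero_iff, norm_mul, Complex.norm_real, Real.norm_of_nonneg ht.1]
      exact (mul_le_of_le_one_left (norm_nonneg _) ht.2).trans_lt hw1
    have hd : ∀ t ∈ uIcc (0 : ℝ) 1, HasDerivAt (fun t : ℝ ↦ g (t * w))
        (w / (1 - aeval ((t : ℂ) * w) Q)) t := fun t ht ↦ by
      have h1 : HasDerivAt (fun t : ℝ ↦ (t : ℂ) * w) w t := by
        simpa using (Complex.ofRealCLM.hasDerivAt (x := t)).mul_const w
      refine ((hg _ (hmem t ht)).comp t h1).congr_deriv ?_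
      ring
    have hi : IntervalIntegrable (fun t : ℝ ↦ w / (1 - aeval ((t : ℂ) * w) Q)) volume 0 1 := by
      refine ContinuousOn.intervalIntegrable fun t ht ↦ ContinuousAt.continuousWithinAt ?_
      have h1 : 1 - aeval ((t : ℂ) * w) Q ≠ 0 := hQ.one_sub_aeval_ne_zero (by simpa using hmem t ht)
      have h2 : Continuous fun t : ℝ ↦ 1 - aeval ((t : ℂ) * w) Q := by fun_prop
      exact continuousAt_const.div h2.continuousAt h1
    rw [phi, intervalIntegral.integral_eq_sub_of_hasDerivAt hd hi]
    simp [g0]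
  refine (hg z (by simpa using hz)).congr_of_eventuallyEq ?_
  filter_upwards [Metric.isOpen_ball.mem_nhds (show z ∈ Metric.ball (0 : ℂ) 1 by simpa using hz)] with w hw
  exact key w hw

end phi

lemma hasDerivAt_lap {v : ℝ → ℝ} (hv : Lap v) (hxv : Lap fun x ↦ x * v x) {z : ℂ} (hz : 0 < z.re) :
    HasDerivAt (lap v) (-lap (fun x ↦ x * v x) z) z := by
  have mv := hv.meas
  have h2 : 0 < z.re / 2 := by positivity
  have := (hasDerivAt_integral_of_dominated_loc_of_deriv_le (μ := volume)
    (F := fun (z : ℂ) (x : ℝ) ↦ Complex.exp (-(z * x)) * (v x : ℂ))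
    (F' := fun (z : ℂ) (x : ℝ) ↦ -(Complex.exp (-(z * x)) * ((x * v x : ℝ) : ℂ)))
    -- Restricting to `Re w > Re z / 2` gives an integrable majorant independent of `w`.
    (bound := fun x ↦ ‖Real.exp (-(z.re / 2 * x)) * (x * v x)‖) (x₀ := z)
    (s := {w | z.re / 2 < w.re})
    ((isOpen_lt continuous_const Complex.continuous_re).mem_nhds (by simp; linarith))
    (Filter.Eventually.of_forall fun w ↦ by fun_prop) (hv.integrable hz) (by fun_prop)
    (Filter.Eventually.of_forall fun x w hw ↦ ?_) (hxv.int _ h2).norm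
    (Filter.Eventually.of_forall fun x w hw ↦ ?_)).2
  · refine this.congr_deriv ?_
    rw [lap, ← integral_neg]
  · have hw : z.re / 2 < w.re := hw
    rw [norm_neg, norm_cexp_mul (fun x ↦ x * v x)]
    simp only [norm_mul, Real.norm_eq_abs, Real.abs_exp]
    rcases le_or_gt x 0 with hx | hx
    · simp [hv.supp x hx]
    · gcongr
  · have h1 : HasDerivAt (fun w : ℂ ↦ -(w * x)) (-(1 * x)) w := ((hasDerivAt_id w).mul_const (x : ℂ)).neg
    refine (h1.cexp.mul_const (v x : ℂ)).congr_deriv ?_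
    push_cast
    ring

/-- Support beyond `1` yields the factor `e^{-(s-1)}` relative to the transform at `1`. -/
lemma tendsto_lap_atTop {v : ℝ → ℝ} (hv : Lap v) (h1 : ∀ x ≤ 1, v x = 0) :
    Filter.Tendsto (fun s : ℝ ↦ lap v s) Filter.atTop (𝓝 0) := by
  refine squeeze_zero_norm' (a := fun s ↦ Real.exp (-(s - 1)) * ∫ x, ‖Real.exp (-(1 * x)) * v x‖) ?_ ?_
  · filter_upwards [Filter.eventually_ge_atTop 1] with s hs
    rw [← integral_const_mul]
    refine norm_integral_le_of_norm_le ((hv.int 1 one_pos).norm.const_mul _)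
      (Filter.Eventually.of_forall fun x ↦ ?_)
    rw [norm_cexp_mul]
    simp only [norm_mul, Real.norm_eq_abs, Real.abs_exp]
    rw [← mul_assoc, ← Real.exp_add, Complex.ofReal_re]
    rcases le_or_gt x 1 with hx | hx
    · simp [h1 x hx]
    · gcongr
      nlinarith
  · have : Filter.Tendsto (fun s : ℝ ↦ Real.exp (-(s - 1))) Filter.atTop (𝓝 0) :=
      Real.tendsto_exp_neg_atTop_nhds_zero.comp
        (Filter.tendsto_atTop_add_const_right _ (-1) Filter.tendsto_id)
    simpa using this.mul_const (∫ x, ‖Real.exp (-(1 * x)) * v x‖)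

lemma Lap.div_id {v : ℝ → ℝ} (hv : Lap v) (h1 : ∀ x ≤ 1, v x = 0) : Lap fun x ↦ v x / x := by
  have mv := hv.meas
  refine ⟨by fun_prop, fun x hx ↦ by simp [hv.supp x hx], fun s hs ↦ ?_⟩
  refine (hv.int s hs).mono (by fun_prop) (Filter.Eventually.of_forall fun x ↦ ?_)
  rcases le_or_gt x 1 with hx | hx
  · simp [h1 x hx]
  · rw [norm_mul, norm_mul, norm_div]
    gcongr
    exact div_le_self (norm_nonneg _) (hx.le.trans (le_abs_self x))

lemma mul_div_id {v : ℝ → ℝ} (h1 : ∀ x ≤ 1, v x = 0) : (fun x ↦ x * (v x / x)) = v := by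
  funext x
  rcases le_or_gt x 1 with hx | hx
  · simp [h1 x hx]
  · field_simp

/-- A function whose product with the identity has the transform `φ'(η̂) η̂'` has the transform
`φ(η̂)`. -/
lemma Dens.lap_div_id_eq_phi {γ : ℝ} {η : ℝ → ℝ} (h : Dens γ η) (hγ : 3 / 2 < γ) {Q : ℝ[X]}
    (hQ : IsMergingPolynomial Q) {D : ℝ → ℝ} (hD : Lap D) (hD1 : ∀ x ≤ 1, D x = 0)
    (hDz : ∀ z : ℂ, 0 < z.re → Coarsening.lap D z =
      Coarsening.lap (fun x ↦ x * η x) z / (1 - aeval (Coarsening.lap η z) Q)) {z : ℂ} (hz : 0 < z.re) :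
    Coarsening.lap (fun x ↦ D x / x) z = phi Q (Coarsening.lap η z) := by
  have hW := hD.div_id hD1
  have hlt : ∀ z : ℂ, 0 < z.re → ‖Coarsening.lap η z‖ < 1 := fun z hz ↦
    (h.norm_lap_le hz.le).trans_lt (by simpa using hz)
  set Φ : ℂ → ℂ := fun z ↦ Coarsening.lap (fun x ↦ D x / x) z - phi Q (Coarsening.lap η z)
  have hd : ∀ z : ℂ, 0 < z.re → HasDerivAt Φ 0 z := by
    intro z hz
    have h1 := hasDerivAt_lap hW (by rwa [mul_div_id hD1]) hz
    rw [mul_div_id hD1] at h1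
    have h2 := (hasDerivAt_phi hQ (hlt z hz)).comp z (hasDerivAt_lap h.lap (h.lap_id_mul hγ).2.2 hz)
    refine (h1.sub h2).congr_deriv ?_
    rw [hDz z hz]; ring
  have hopen : IsOpen {z : ℂ | 0 < z.re} := isOpen_lt continuous_const Complex.continuous_re
  have hconst : ∀ s : ℝ, 0 < s → Φ s = Φ z := fun s hs ↦
    hopen.is_const_of_deriv_eq_zero (convex_halfSpace_re_gt 0).isPreconnected
      (fun w hw ↦ (hd w hw).differentiableAt.differentiableWithinAt) (fun w hw ↦ (hd w hw).deriv)
      (by simpa using hs) hz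
  -- The constant of integration is zero: both transforms vanish at `+∞`, and `φ(0) = 0`.
  have hlim : Filter.Tendsto (fun s : ℝ ↦ Φ s) Filter.atTop (𝓝 0) := by
    have h1 := tendsto_lap_atTop hW fun x hx ↦ by simp [hD1 x hx]
    have h2 := (hasDerivAt_phi hQ (z := 0) (by simp)).continuousAt.tendsto.comp
      (tendsto_lap_atTop h.lap h.supp)
    rw [phi_zero] at h2
    simpa using h1.sub h2
  have : Φ z = 0 := tendsto_nhds_unique (tendsto_const_nhds.congr' (by
    filter_upwards [Filter.eventually_gt_atTop 0] with s hs
    exact (hconst s hs).symm)) hlim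
  exact sub_eq_zero.1 this

lemma fourier_eq_lap {v w : ℝ → ℝ} (hw : ∀ x ≤ 1, w x = 0)
    (h : v =ᵐ[volume.restrict (Ioi 1)] w) (ξ : ℂ) :
    fourier v ξ = lap w (Complex.I * ξ) := by
  have h1 : lap w (Complex.I * ξ) =
      ∫ x in Ioi (1 : ℝ), Complex.exp (-(Complex.I * ξ * x)) * (w x : ℂ) :=
    (setIntegral_eq_integral_of_forall_compl_eq_zero fun x hx ↦ by simp [hw x (not_lt.1 hx)]).symm
  rw [fourier, h1]
  refine integral_congr_ae ?_
  filter_upwards [h] with x hx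
  rw [hx]; ring_nf

lemma Lap.locallyIntegrable {v : ℝ → ℝ} (hv : Lap v) : LocallyIntegrable v := by
  have h1 : LocallyIntegrable (fun x ↦ Real.exp (-(1 * x)) * v x) := (hv.int 1 one_pos).locallyIntegrable
  have h2 := (locallyIntegrableOn_univ.2 h1).continuousOn_mul
    (g := fun x ↦ Real.exp x) (by fun_prop) (isOpen_univ.isLocallyClosed)
  rw [locallyIntegrableOn_univ] at h2
  convert h2 using 2 with x
  rw [← mul_assoc, ← Real.exp_add]; simp

lemma isN_of_lap {Q : ℝ[X]} {η η₀ W : ℝ → ℝ} (h₀ : ∀ x ≤ 1, η₀ x = 0)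
    (hη : η =ᵐ[volume.restrict (Ioi 1)] η₀) (hW : Lap W) (hW1 : ∀ x ≤ 1, W x = 0)
    (h : ∀ z : ℂ, 0 < z.re → lap W z = phi Q (lap η₀ z)) : IsN Q η W where
  locallyIntegrable := hW.locallyIntegrable.locallyIntegrableOn _
  integrable ξ hξ := by
    have := (hW.integrable (z := Complex.I * ξ) (by simpa using hξ)).integrableOn (s := Ioi 1)
    refine this.congr (Filter.Eventually.of_forall fun x ↦ ?_)
    ring_nf
  fourier_eq ξ hξ := by
    rw [fourier_eq_lap hW1 Filter.EventuallyEq.rfl, fourier_eq_lap h₀ hη, h _ (by simpa using hξ)]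

/-- `𝒩(η)` is unique. -/
lemma IsN.ae_eq {Q : ℝ[X]} {η v w : ℝ → ℝ} (hv : IsN Q η v) (hw : IsN Q η w) :
    v =ᵐ[volume.restrict (Ioi 1)] w := by
  -- The difference is weighted by `e^{-x}`, so its Fourier transform is the difference of the two
  -- Laplace transforms on the line `Im ξ = -1`.
  set a : ℝ → ℂ := (Ioi (1 : ℝ)).indicator fun x ↦ Complex.exp (-Complex.I * (-Complex.I) * x) *
    ((v x : ℂ) - w x) with ha
  have him (t : ℝ) : (-Complex.I + 2 * Real.pi * t).im < 0 := by simp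
  have hi : Integrable a := by
    rw [ha, integrable_indicator_iff measurableSet_Ioi]
    simp only [mul_sub]
    exact (hv.integrable (-Complex.I) (by simp)).sub (hw.integrable (-Complex.I) (by simp))
  have h0 : a =ᵐ[volume] 0 := ae_eq_zero_of_fourier_eq_zero hi fun t ↦ by
    have h1 := (hv.fourier_eq _ (him t)).trans (hw.fourier_eq _ (him t)).symm
    rw [← sub_eq_zero, fourier, fourier,
      ← integral_sub (hv.integrable _ (him t)) (hw.integrable _ (him t))] at h1
    rw [Real.fourier_eq', ← h1, ← integral_indicator measurableSet_Ioi]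
    congr 1 with x
    by_cases hx : x ∈ Ioi (1 : ℝ)
    · rw [ha, indicator_of_mem hx, indicator_of_mem hx, smul_eq_mul, ← mul_assoc, ← Complex.exp_add,
        ← mul_sub]
      congr 2
      simp
      ring_nf
      rw [Complex.I_sq]
      ring
    · rw [ha, indicator_of_notMem hx, indicator_of_notMem hx, smul_zero]
  have h2 := ae_restrict_of_ae (s := Ioi (1 : ℝ)) h0
  filter_upwards [h2, ae_restrict_mem measurableSet_Ioi] with x hx hx1
  rw [ha, indicator_of_mem hx1, Pi.zero_apply, mul_eq_zero, sub_eq_zero] at hx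
  exact Complex.ofReal_injective (hx.resolve_left (Complex.exp_ne_zero _))

end Coarsening

/-! ### The constants `κ` and Euler's constant, and the integral of the remainder. -/

namespace Coarsening
open scoped ENNReal Topology

section kappa

variable {Q : ℝ[X]}

lemma IsMergingPolynomial.eval_le (hQ : IsMergingPolynomial Q) {x : ℝ} (h0 : 0 ≤ x) (h1 : x ≤ 1) :
    Q.eval x ≤ x := by
  have h := hQ.norm_aeval_le (z := x) (by rwa [Complex.norm_real, Real.norm_of_nonneg h0])
  have e : aeval (x : ℂ) Q = (Q.eval x : ℝ) := aeval_algebraMap_apply_eq_algebraMap_eval _ _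
  rw [e, Complex.norm_real, Complex.norm_real, Real.norm_of_nonneg h0] at h
  exact (le_abs_self _).trans h

/-- The singularity at `1` is removable: with `1 - Q = (1 - z) S` and `S - q = (z - 1) T`, the
integrand is `-T/S` off `z = 1`, and `S` has no zero on `[0, 1]`. -/
lemma intervalIntegrable_kappa (hQ : IsMergingPolynomial Q) :
    IntervalIntegrable (fun z ↦ 1 / (1 - z) - q Q / (1 - Q.eval z)) volume 0 1 := by
  obtain ⟨S, hS, hS1⟩ := exists_one_sub_eq_mul hQ
  have hr : (S - C (q Q)).IsRoot 1 := by simp [hS1]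
  obtain ⟨T, hT⟩ := dvd_iff_isRoot.2 hr
  have hev (z : ℝ) : 1 - Q.eval z = (1 - z) * S.eval z := by
    simpa using congrArg (eval z) hS
  have hTv (z : ℝ) : S.eval z - q Q = (z - 1) * T.eval z := by
    simpa using congrArg (eval z) hT
  have hpos : ∀ z ∈ Icc (0 : ℝ) 1, S.eval z ≠ 0 := fun z hz ↦ by
    rcases hz.2.eq_or_lt with rfl | h1
    · rw [hS1]; linarith [hQ.one_le_q]
    · intro h0
      have h2 := hev z
      rw [h0, mul_zero] at h2
      linarith [hQ.eval_le hz.1 hz.2]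
  have hc : ContinuousOn (fun z ↦ -(T.eval z / S.eval z)) (uIcc 0 1) := by
    rw [uIcc_of_le zero_le_one]
    exact (T.continuous.continuousOn.div S.continuous.continuousOn hpos).neg
  refine hc.intervalIntegrable.congr_ae ?_
  rw [uIoc_of_le zero_le_one, ← restrict_Ioo_eq_restrict_Ioc]
  filter_upwards [ae_restrict_mem measurableSet_Ioo] with z hz
  have h1 : 1 - z ≠ 0 := by linarith [hz.2]
  have h2 := hpos z ⟨hz.1.le, hz.2.le⟩
  rw [hev]
  field_simp
  linear_combination (-1) * hTv z

/-- This separates the logarithmic singularity of `φ` at `1` from a part that stays bounded and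
tends to `-(log κ)/q`. -/
lemma re_phi_eq (hQ : IsMergingPolynomial Q) {x : ℝ} (h0 : 0 ≤ x) (h1 : x < 1) :
    (phi Q x).re = -(1 / q Q) * (Real.log (1 - x) +
      ∫ z in (0 : ℝ)..x, (1 / (1 - z) - q Q / (1 - Q.eval z))) := by
  have hq : 0 < q Q := by linarith [hQ.one_le_q]
  have hd : ∀ t ∈ uIcc 0 x, HasDerivAt (fun t : ℝ ↦ -Real.log (1 - t) - q Q * (phi Q t).re)
      (1 / (1 - t) - q Q / (1 - Q.eval t)) t := by
    intro t ht
    rw [uIcc_of_le h0] at ht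
    have ht1 : t < 1 := ht.2.trans_lt h1
    have e : aeval (t : ℂ) Q = (Q.eval t : ℝ) := aeval_algebraMap_apply_eq_algebraMap_eval _ _
    have d1 := (hasDerivAt_phi hQ (z := (t : ℂ)) (by
      rwa [Complex.norm_real, Real.norm_of_nonneg ht.1])).real_of_complex
    have d2 := ((hasDerivAt_id t).const_sub 1).log (by simp; linarith)
    refine (d2.neg.sub (d1.const_mul (q Q))).congr_deriv ?_
    have : (1 / (1 - aeval (t : ℂ) Q)).re = 1 / (1 - Q.eval t) := by
      rw [e]
      norm_cast
    rw [this]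
    simp only [id]
    ring
  have hi : IntervalIntegrable (fun z ↦ 1 / (1 - z) - q Q / (1 - Q.eval z)) volume 0 x :=
    (intervalIntegrable_kappa hQ).mono_set (by
      rw [uIcc_of_le h0, uIcc_of_le zero_le_one]; exact Icc_subset_Icc_right h1.le)
  rw [intervalIntegral.integral_eq_sub_of_hasDerivAt hd hi]
  simp only [Complex.ofReal_zero, phi_zero, Complex.zero_re, sub_zero, Real.log_one, neg_zero, mul_zero]
  field_simp
  ring

lemma tendsto_integral_kappa (hQ : IsMergingPolynomial Q) :
    Filter.Tendsto (fun x ↦ ∫ z in (0 : ℝ)..x, (1 / (1 - z) - q Q / (1 - Q.eval z))) (𝓝[<] 1)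
      (𝓝 (Real.log (kappa Q))) := by
  rw [kappa, Real.log_exp]
  have h := (intervalIntegrable_iff_integrableOn_Icc_of_le zero_le_one).1 (intervalIntegrable_kappa hQ)
  have := (intervalIntegral.continuousOn_primitive_interval (a := 0) (b := 1) (by
    rwa [uIcc_of_le zero_le_one])) 1 (by simp)
  rw [uIcc_of_le zero_le_one] at this
  refine this.mono_left (nhdsWithin_le_of_mem ?_)
  exact Filter.mem_of_superset (Ioo_mem_nhdsLT one_pos) Ioo_subset_Icc_self

end kappa

section euler

/-- The integral is `Γ'(1)`, by differentiating the Gamma integral. -/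
lemma integral_log_mul_exp_neg :
    ∫ t in Ioi (0 : ℝ), Real.log t * Real.exp (-t) = -Real.eulerMascheroniConstant := by
  have h1 := Complex.hasDerivAt_GammaIntegral (s := 1) (by simp)
  have h2 : Complex.Gamma =ᶠ[𝓝 1] Complex.GammaIntegral := by
    filter_upwards [(isOpen_lt continuous_const Complex.continuous_re).mem_nhds
      (show (1 : ℂ) ∈ {z : ℂ | 0 < z.re} by simp)] with z hz
    exact Complex.Gamma_eq_integral hz
  have h3 := (h1.congr_of_eventuallyEq h2).unique Complex.hasDerivAt_Gamma_one
  simp only [sub_self, Complex.cpow_zero, one_mul] at h3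
  have h4 : ∫ t in Ioi (0 : ℝ), (Real.log t : ℂ) * (Real.exp (-t) : ℂ) =
      ((∫ t in Ioi (0 : ℝ), Real.log t * Real.exp (-t) : ℝ) : ℂ) := by
    rw [← integral_complex_ofReal]; simp
  rw [h4] at h3
  exact_mod_cast h3

lemma integrableOn_log_mul_exp_neg :
    IntegrableOn (fun t ↦ Real.log t * Real.exp (-t)) (Ioi 0) := by
  -- A non-integrable function would have integral `0` by convention, but the value is `-γ_E ≠ 0`.
  by_contra h
  have h1 := integral_log_mul_exp_neg
  rw [integral_undef h] at h1
  linarith [Real.one_half_lt_eulerMascheroniConstant]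

/-- `1/x` on `(1,∞)`, extended by zero. -/
noncomputable def invTail (x : ℝ) : ℝ := Coarsening.step (x - 1) / x

lemma step_sub_one_eq_zero : ∀ x ≤ 1, Coarsening.step (x - 1) = 0 := fun x hx ↦ by
  simp [Coarsening.step, hx.not_gt]

lemma Lap.step_sub_one : Lap fun x ↦ Coarsening.step (x - 1) := Lap.step.shift 1 zero_le_one

lemma Lap.invTail : Lap invTail := Lap.step_sub_one.div_id step_sub_one_eq_zero

lemma conv_invTail_step (x : ℝ) : conv invTail Coarsening.step x = if 1 < x then Real.log x else 0 := by
  split_ifs with h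
  · have : conv invTail Coarsening.step x = ∫ t in Ioo 1 x, t⁻¹ := by
      rw [← integral_indicator measurableSet_Ioo]
      refine integral_congr_ae (Filter.Eventually.of_forall fun t ↦ ?_)
      by_cases h1 : 1 < t <;> by_cases h2 : t < x <;> simp [invTail, Coarsening.step, indicator, h1, h2]
    rw [this, ← integral_Ioc_eq_integral_Ioo, ← intervalIntegral.integral_of_le h.le,
      integral_inv_of_pos one_pos (by linarith), div_one]
  · exact conv_eq_zero (r := 1) (fun t ht ↦ by simp [invTail, step_sub_one_eq_zero t ht]) Lap.step.supp
      x (not_lt.1 h)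

/-- Convolution with the step function turns `1/x` on `(1,∞)` into `log x` there and divides the
transform by `s`; it replaces an integration by parts. -/
lemma integral_tilt_invTail {s : ℝ} (hs : 0 < s) :
    ∫ x, tilt s invTail x = s * ∫ x in Ioi (1 : ℝ), Real.log x * Real.exp (-(s * x)) := by
  have hz : 0 < (s : ℂ).re := by simpa using hs
  have h1 := lap_conv Lap.invTail Lap.step hz
  rw [lap_step hz, lap_ofReal, lap_ofReal] at h1
  have h2 : ∫ x, tilt s (conv invTail Coarsening.step) x =
      ∫ x in Ioi (1 : ℝ), Real.log x * Real.exp (-(s * x)) := by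
    rw [← integral_indicator measurableSet_Ioi]
    refine integral_congr_ae (Filter.Eventually.of_forall fun x ↦ ?_)
    by_cases h : 1 < x <;> simp [tilt, conv_invTail_step, indicator, h, mul_comm]
  rw [h2] at h1
  have h3 : ∫ x in Ioi (1 : ℝ), Real.log x * Real.exp (-(s * x)) = (∫ x, tilt s invTail x) * (1 / s) := by
    exact_mod_cast h1
  rw [h3]
  field_simp

lemma tendsto_integral_invTail :
    Filter.Tendsto (fun s ↦ (∫ x, tilt s invTail x) + Real.log s) (𝓝[>] 0)
      (𝓝 (-Real.eulerMascheroniConstant)) := by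
  -- Extend the logarithmic integral from `(1,∞)` to `(0,∞)` and substitute `t = s x`; the
  -- correction over `(0, 1]` carries a factor `s` and disappears in the limit.
  have key : ∀ s : ℝ, 0 < s → (∫ x, tilt s invTail x) + Real.log s = -Real.eulerMascheroniConstant -
      s * ∫ x in Ioc (0 : ℝ) 1, Real.log x * Real.exp (-(s * x)) := by
    intro s hs
    have h1 := integral_comp_mul_left_Ioi (fun t ↦ Real.log t * Real.exp (-t)) 0 hs
    rw [mul_zero, integral_log_mul_exp_neg] at h1
    have i1 : IntegrableOn (fun x ↦ Real.log (s * x) * Real.exp (-(s * x))) (Ioi 0) :=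
      (integrableOn_Ioi_comp_mul_left_iff (fun t ↦ Real.log t * Real.exp (-t)) 0 hs).2 (by
        rw [mul_zero]; exact integrableOn_log_mul_exp_neg)
    have i2 : IntegrableOn (fun x ↦ Real.log s * Real.exp (-(s * x))) (Ioi 0) := by
      have := (integrableOn_exp_mul_Ioi (a := -s) (by linarith) 0).const_mul (Real.log s)
      simp only [neg_mul] at this
      exact this
    have i2v : ∫ x in Ioi (0 : ℝ), Real.log s * Real.exp (-(s * x)) = Real.log s * s⁻¹ := by
      have := integral_exp_mul_Ioi (a := -s) (by linarith) 0
      rw [integral_const_mul]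
      simp only [neg_mul, mul_zero, Real.exp_zero] at this
      rw [this]
      simp [neg_div_neg_eq]
    have e : ∀ x ∈ Ioi (0 : ℝ), Real.log x * Real.exp (-(s * x)) =
        Real.log (s * x) * Real.exp (-(s * x)) - Real.log s * Real.exp (-(s * x)) := fun x hx ↦ by
      rw [Real.log_mul hs.ne' (ne_of_gt hx)]; ring
    have i3 : IntegrableOn (fun x ↦ Real.log x * Real.exp (-(s * x))) (Ioi 0) :=
      (i1.sub i2).congr_fun (fun x hx ↦ (e x hx).symm) measurableSet_Ioi
    have h2 : ∫ x in Ioi (0 : ℝ), Real.log x * Real.exp (-(s * x)) =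
        s⁻¹ * (-Real.eulerMascheroniConstant) - Real.log s * s⁻¹ := by
      rw [setIntegral_congr_fun measurableSet_Ioi e, integral_sub i1 i2, h1, i2v, smul_eq_mul]
    rw [← Ioc_union_Ioi_eq_Ioi zero_le_one, setIntegral_union Ioc_disjoint_Ioi_same measurableSet_Ioi
      (i3.mono_set Ioc_subset_Ioi_self) (i3.mono_set (Ioi_subset_Ioi zero_le_one))] at h2
    rw [integral_tilt_invTail hs]
    have h4 : s * s⁻¹ = 1 := mul_inv_cancel₀ hs.ne'
    linear_combination s * h2 + (-Real.eulerMascheroniConstant - Real.log s) * h4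
  have hlog : IntegrableOn Real.log (Ioc 0 1) :=
    (intervalIntegrable_iff_integrableOn_Ioc_of_le zero_le_one).1 intervalIntegral.intervalIntegrable_log'
  have hlim : Filter.Tendsto (fun s : ℝ ↦ s * ∫ x in Ioc (0 : ℝ) 1, Real.log x * Real.exp (-(s * x)))
      (𝓝[>] 0) (𝓝 0) := by
    refine squeeze_zero_norm' (a := fun s ↦ s * ∫ x in Ioc (0 : ℝ) 1, ‖Real.log x‖) ?_ ?_
    · filter_upwards [self_mem_nhdsWithin] with s hs
      have hs : 0 < s := hs
      rw [norm_mul, Real.norm_of_nonneg hs.le]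
      gcongr
      refine norm_integral_le_of_norm_le hlog.norm ?_
      filter_upwards [ae_restrict_mem measurableSet_Ioc] with x hx
      rw [norm_mul, Real.norm_eq_abs (Real.exp _), Real.abs_exp]
      refine mul_le_of_le_one_right (norm_nonneg _) ?_
      rw [Real.exp_le_one_iff]
      have := mul_pos hs hx.1
      linarith
    · have : Filter.Tendsto (fun s : ℝ ↦ s * ∫ x in Ioc (0 : ℝ) 1, ‖Real.log x‖) (𝓝 0) (𝓝 (0 * _)) :=
        Filter.tendsto_id.mul_const _
      rw [zero_mul] at this
      exact this.mono_left nhdsWithin_le_nhds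
  have := hlim.const_sub (-Real.eulerMascheroniConstant)
  rw [sub_zero] at this
  refine this.congr' ?_
  filter_upwards [self_mem_nhdsWithin] with s hs
  exact (key s hs).symm

end euler

lemma sqn_div_id_lt_top {c : ℝ} {E : ℝ → ℝ} (hE : Measurable E) (h1 : ∀ x ≤ 1, E x = 0)
    (h : sqn c E < ∞) : sqn (c + 1) (fun x ↦ E x / x) < ∞ := by
  have : sqn (c + 1) (fun x ↦ E x / x) ≤ 2 ^ 2 * sqn c E := by
    rw [sqn, sqn, ← lintegral_const_mul _ (by fun_prop)]
    refine lintegral_mono fun x ↦ ?_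
    rcases le_or_gt x 1 with hx | hx
    · simp [h1 x hx]
    · have hx0 : 0 < x := by linarith
      rw [← mul_pow, ← wt_mul, div_eq_mul_inv, enorm_mul]
      have h2 : wt 1 x * ‖x⁻¹‖ₑ ≤ 2 := by
        rw [wt, Real.rpow_one, Real.enorm_of_nonneg (by positivity), ← ENNReal.ofReal_mul (by positivity),
          abs_of_pos hx0]
        refine (ENNReal.ofReal_le_ofReal (q := 2) ?_).trans (by simp)
        rw [← div_eq_mul_inv, div_le_iff₀ hx0]
        linarith
      refine pow_le_pow_left' ?_ 2
      calc _ = (wt 1 x * ‖x⁻¹‖ₑ) * (wt c x * ‖E x‖ₑ) := by ring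
        _ ≤ _ := by gcongr
  exact this.trans_lt (by finiteness)

lemma memL2_of_sqn {c : ℝ} (hc : 0 ≤ c) {d : ℝ → ℝ} (hd : Lap d) (h : sqn c d < ∞) : MemL2 c d where
  locallyIntegrable := hd.locallyIntegrable.locallyIntegrableOn _
  memLp := by
    have md := hd.meas
    refine ⟨by fun_prop, ?_⟩
    rw [eLpNorm_lt_top_iff_lintegral_rpow_enorm_lt_top (by norm_num) (by norm_num)]
    refine lt_of_le_of_lt ((setLIntegral_mono' measurableSet_Ioi fun x hx ↦ ?_).trans
      (setLIntegral_le_lintegral (Ioi 1) _)) h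
    have hx : 0 < x := lt_trans one_pos hx
    rw [enorm_mul, Real.enorm_of_nonneg (by positivity), ENNReal.toReal_ofNat, ENNReal.rpow_ofNat]
    gcongr
    exact ofReal_rpow_le_wt hc hx

/-- A measurable representative of a density. -/
lemma exists_dens {γ : ℝ} (hγ : 0 ≤ γ) {η : ℝ → ℝ} (hη : MemP η) (hηγ : MemL2 γ η) :
    ∃ η₀, Dens γ η₀ ∧ η =ᵐ[volume.restrict (Ioi 1)] η₀ := by
  obtain ⟨g, hg, hge⟩ := hη.integrable.aestronglyMeasurable
  have hgm := hg.measurable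
  -- Truncation at `0` makes the representative nonnegative everywhere rather than almost
  -- everywhere.
  set η₀ : ℝ → ℝ := (Ioi (1 : ℝ)).indicator fun x ↦ max (g x) 0 with hη₀
  have he : η =ᵐ[volume.restrict (Ioi 1)] η₀ := by
    filter_upwards [hge, hη.nonneg, ae_restrict_mem measurableSet_Ioi] with x h1 h2 h3
    rw [hη₀, indicator_of_mem h3, ← h1, max_eq_left h2]
  have supp : ∀ x ≤ 1, η₀ x = 0 := fun x hx ↦ indicator_of_notMem (not_lt.2 hx) _
  have hind : η₀ = (Ioi (1 : ℝ)).indicator η₀ := by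
    rw [hη₀, indicator_indicator, inter_self]
  have meas : Measurable η₀ := (hgm.max measurable_const).indicator measurableSet_Ioi
  refine ⟨η₀, ⟨meas, fun x ↦ indicator_nonneg (fun _ _ ↦ le_max_right _ _) x, supp, ?_, ?_, ?_⟩, he⟩
  · rw [hind, integrable_indicator_iff measurableSet_Ioi]
    exact hη.integrable.congr he
  · rw [hind, integral_indicator measurableSet_Ioi, ← integral_congr_ae he, hη.integral_eq_one]
  · have h1 : sqn γ η₀ ≤ ENNReal.ofReal (2 ^ γ) ^ 2 *
        ∫⁻ x in Ioi (1 : ℝ), ‖x ^ γ * η x‖ₑ ^ 2 := by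
      rw [← lintegral_const_mul' _ _ (by finiteness), sqn]
      calc _ = ∫⁻ x in Ioi (1 : ℝ), (wt γ x * ‖η₀ x‖ₑ) ^ 2 := by
            rw [← lintegral_indicator measurableSet_Ioi]
            refine lintegral_congr fun x ↦ ?_
            by_cases hx : x ∈ Ioi (1 : ℝ)
            · rw [indicator_of_mem hx]
            · rw [indicator_of_notMem hx, supp x (not_lt.1 hx)]; simp
        _ ≤ _ := by
            refine lintegral_mono_ae ?_
            filter_upwards [he, ae_restrict_mem measurableSet_Ioi] with x hx hx1
            have hx1 : 1 < x := hx1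
            have hx0 : 0 < x := by linarith
            rw [← hx, ← mul_pow, enorm_mul, Real.enorm_of_nonneg (r := x ^ γ) (by positivity), ← mul_assoc]
            gcongr
            rw [wt, ← ENNReal.ofReal_mul (by positivity), ← Real.mul_rpow (by norm_num) hx0.le,
              abs_of_pos hx0]
            exact ENNReal.ofReal_le_ofReal (Real.rpow_le_rpow (by positivity) (by linarith) hγ)
    have h2 := hηγ.memLp.2
    rw [eLpNorm_lt_top_iff_lintegral_rpow_enorm_lt_top (by norm_num) (by norm_num)] at h2
    simp only [ENNReal.toReal_ofNat, ENNReal.rpow_ofNat] at h2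
    exact h1.trans_lt (ENNReal.mul_lt_top (by finiteness) h2)

/-- The integral of the remainder. -/
lemma Dens.integral_remainder {γ : ℝ} {η : ℝ → ℝ} (h : Dens γ η) (hγ : 3 / 2 < γ) {Q : ℝ[X]}
    (hQ : IsMergingPolynomial Q) {d : ℝ → ℝ} (hd : Lap d) (hi : Integrable d)
    (hdz : ∀ z : ℂ, 0 < z.re → (1 / q Q : ℝ) * Coarsening.lap invTail z + Coarsening.lap d z =
      phi Q (Coarsening.lap η z)) :
    ∫ x, d x = (Real.eulerMascheroniConstant - Real.log (kappa Q * ∫ x, x * η x)) / q Q := by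
  have hq : 0 < q Q := by linarith [hQ.one_le_q]
  have hμ : 0 < ∫ x, x * η x := by linarith [h.one_le_integral_id_mul hγ]
  have hη1 : ∀ s : ℝ, 0 < s → 0 ≤ ∫ x, tilt s η x ∧ ∫ x, tilt s η x < 1 := fun s hs ↦ by
    have hnn : 0 ≤ ∫ x, tilt s η x :=
      integral_nonneg fun x ↦ mul_nonneg (Real.exp_nonneg _) (h.nonneg x)
    have h1 := h.norm_lap_le (z := s) (by simpa using hs.le)
    rw [lap_ofReal, Complex.norm_real, Real.norm_of_nonneg hnn, Complex.ofReal_re] at h1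
    exact ⟨hnn, h1.trans_lt (by simpa using hs)⟩
  have hηt : Filter.Tendsto (fun s ↦ ∫ x, tilt s η x) (𝓝[>] 0) (𝓝[<] 1) := by
    refine tendsto_nhdsWithin_iff.2 ⟨?_, ?_⟩
    · simpa [h.integral] using tendsto_integral_tilt h.meas h.supp0 h.int
    · filter_upwards [self_mem_nhdsWithin] with s hs
      exact (hη1 s hs).2
  -- Inserting `± log s` groups the right side into three convergent terms, with limits `log μ`,
  -- `log κ` and `-γ_E`.
  have key : ∀ s : ℝ, 0 < s → ∫ x, tilt s d x = -(1 / q Q) *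
      (Real.log ((1 - ∫ x, tilt s η x) / s) +
        (∫ z in (0 : ℝ)..(∫ x, tilt s η x), (1 / (1 - z) - q Q / (1 - Q.eval z))) +
        ((∫ x, tilt s invTail x) + Real.log s)) := by
    intro s hs
    have h1 := congrArg Complex.re (hdz s (by simpa using hs))
    obtain ⟨h2, h3⟩ := hη1 s hs
    rw [lap_ofReal, lap_ofReal, lap_ofReal, re_phi_eq hQ h2 h3, ← Complex.ofReal_mul,
      ← Complex.ofReal_add, Complex.ofReal_re] at h1
    rw [Real.log_div (by linarith) hs.ne']
    linear_combination h1
  have hlim := ((((Real.continuousAt_log hμ.ne').tendsto.comp (h.tendsto_one_sub_div hγ)).add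
    ((tendsto_integral_kappa hQ).comp hηt)).add tendsto_integral_invTail).const_mul (-(1 / q Q))
  have h2 := tendsto_nhds_unique (tendsto_integral_tilt hd.meas hd.supp hi) (hlim.congr' (by
    filter_upwards [self_mem_nhdsWithin] with s hs
    rw [key s hs]
    rfl))
  rw [h2, Real.log_mul (show kappa Q ≠ 0 from (Real.exp_pos _).ne') hμ.ne']
  ring

end Coarsening

/-! ### Assembly of the representation, uniqueness and the integral. -/

theorem proposition5p1 (Q : Polynomial ℝ) (hQ : Coarsening.IsMergingPolynomial Q)
    (γ : ℝ) (hγ : 3 / 2 < γ)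
    (η : ℝ → ℝ) (hη : Coarsening.MemP η) (hηγ : Coarsening.MemL2 γ η) :
    ∃ w : ℝ → ℝ,
      Coarsening.IsN Q η w ∧
      (∀ w' : ℝ → ℝ, Coarsening.IsN Q η w' →
        w' =ᵐ[MeasureTheory.volume.restrict (Set.Ioi (1 : ℝ))] w) ∧
      ∃ d : ℝ → ℝ,
        (∀ᵐ y ∂(MeasureTheory.volume.restrict (Set.Ioi (1 : ℝ))),
          w y = 1 / Coarsening.q Q * Coarsening.wstar y + d y) ∧
        Coarsening.MemL2 (γ - 1) d ∧
        MeasureTheory.IntegrableOn (fun y : ℝ => y * η y) (Set.Ioi 1) ∧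
        MeasureTheory.IntegrableOn d (Set.Ioi 1) ∧
        ∫ y in Set.Ioi (1 : ℝ), d y =
          (Real.eulerMascheroniConstant -
            Real.log (Coarsening.kappa Q * ∫ y in Set.Ioi (1 : ℝ), y * η y)) /
            Coarsening.q Q := by
  open Coarsening in
  obtain ⟨η₀, h, he⟩ := exists_dens (by linarith) hη hηγ
  obtain ⟨E, hE, hE1, hEs, hEz⟩ := h.exists_remainder hγ hQ
  -- `D` is `y w(y)`; dividing by `y` gives `w`, with `E / y` as the remainder `d`.
  set D : ℝ → ℝ := fun x ↦ 1 / q Q * Coarsening.step (x - 1) + E x with hD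
  have hS := Lap.step_sub_one.const_mul (1 / q Q)
  have LD : Lap D := hS.add hE
  have D1 : ∀ x ≤ 1, D x = 0 := fun x hx ↦ by simp [hD, hE1 x hx, step_sub_one_eq_zero x hx]
  have hDz : ∀ z : ℂ, 0 < z.re → lap D z =
      lap (fun x ↦ x * η₀ x) z / (1 - aeval (lap η₀ z) Q) := fun z hz ↦ by
    rw [← hEz z hz, lap_add hS hE hz, lap_const_mul, lap_shift, lap_step hz]
    simp [div_eq_mul_inv, add_comm]
  have hWz : ∀ z : ℂ, 0 < z.re → lap (fun x ↦ D x / x) z = phi Q (lap η₀ z) := fun z hz ↦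
    h.lap_div_id_eq_phi hγ hQ LD D1 hDz hz
  have LW := LD.div_id D1
  have hN : IsN Q η fun x ↦ D x / x :=
    isN_of_lap h.supp he LW (fun x hx ↦ by simp [D1 x hx]) hWz
  have Ld := hE.div_id hE1
  have ds := sqn_div_id_lt_top hE.meas hE1 hEs
  rw [show γ - 2 + 1 = γ - 1 by ring] at ds
  have di : Integrable fun x ↦ E x / x :=
    integrable_of_nrm Ld.meas (nrm_lt_top_of_sqn (b := γ - 1) (by linarith) Ld.meas ds)
  have heid : (fun y ↦ y * η y) =ᵐ[volume.restrict (Ioi 1)] fun y ↦ y * η₀ y := by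
    filter_upwards [he] with y hy
    rw [hy]
  refine ⟨_, hN, fun w' hw' ↦ hw'.ae_eq hN, fun x ↦ E x / x, ?_, memL2_of_sqn (by linarith) Ld ds,
    (h.lap_id_mul hγ).1.integrableOn.congr heid.symm, di.integrableOn, ?_⟩
  · filter_upwards [ae_restrict_mem measurableSet_Ioi] with x hx
    have hx : 1 < x := hx
    simp only [hD, wstar, Coarsening.step, if_pos hx.le, if_pos (sub_pos.2 hx)]
    ring
  · rw [integral_congr_ae heid, setIntegral_eq_integral_of_forall_compl_eq_zero
      fun x hx ↦ by simp [hE1 x (not_lt.1 hx)], setIntegral_eq_integral_of_forall_compl_eq_zero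
      fun x hx ↦ by simp [h.supp x (not_lt.1 hx)]]
    refine h.integral_remainder hγ hQ Ld di fun z hz ↦ ?_
    rw [← hWz z hz, ← lap_const_mul, ← lap_add (Lap.invTail.const_mul _) Ld hz]
    congr 1
    funext x
    simp only [hD, invTail]
    ring
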